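/- **Proposition (Existence of Split Dynamics).** Let $P:\mathbb R^N\to\mathbb R^N$ be of class $C^1$, and let $\boldsymbol x:[0,T]\to\mathbb R^N$, $T>0$, be a solution of $\dot{\boldsymbol x}=P(\boldsymbol x)$, $\boldsymbol x(0)=\boldsymbol x_0$, whose orbit $\mathcal X(\boldsymbol x_0)=\boldsymbol x([0,T])$ is a simple curve: $\boldsymbol x$ is injective on $[0,T]$ and $P(\boldsymbol x(t))\neq 0$ for all $t\in[0,T]$. A *coordinate system* on an open set $U\subseteq\mathbb R^N$ is a $C^1$ diffeomorphism of $U$ onto an open subset of $\mathbb R^N$. A *regular neighborhood* of $\mathcal X(\boldsymbol x_0)$ is an open set $\mathcal N\supseteq\mathcal X(\boldsymbol x_0)$ that contains no equilibrium ($P\ne0$ on $\mathcal N$) and is foliated by parallel orbit curves: for some index $i_0$, some interval $(a,b)$ with $a<b$ and some $\varepsilon>0$, there is a coordinate system $\psi$ on $\mathcal N$ with image the ruled box $\{z:\ z_{i_0}\in(a,b),\ |z_j|<\varepsilon\ (j\ne i_0)\}$ such that, along every solution of $\dot{\boldsymbol x}=P(\boldsymbol x)$ defined on an open time interval and staying in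 $\mathcal N$, each $\psi_j$ with $j\neq i_0$ is constant. The dynamic is *split* on an open set $U$ if there are a coordinate system $\boldsymbol y=F(\boldsymbol x)$ on $U$ with $\det DF(\boldsymbol x)\neq 0$ for all $\boldsymbol x\in U$, and functions $q_1,\dots,q_N$ of one real variable, $q_i$ continuous on $F_i(U)$, such that a curve in $U$ defined on an open time interval solves $\dot{\boldsymbol x}=P(\boldsymbol x)$ if and only if its image $\boldsymbol y=F(\boldsymbol x)$ solves $$\dot y_1=q_1(y_1),\quad\dots,\quad \dot y_N=q_N(y_N).$$ Then: 1. the dynamic is split on every regular neighborhood $\mathcal N$ of $\mathcal X(\boldsymbol x_0)$; 2. every open set $\mathcal O\supseteq\mathcal X(\boldsymbol x_0)$ contains a regular neighborhood $\mathcal N\subseteq\mathcal O$ of $\mathcal X(\boldsymbol x_0)$, and the dynamic is split on $\mathcal N$. -/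

import Mathlib

open Set

/-- `x` solves `ẋ = P(x)`, `x(0) = x₀`, on the time interval `[0, T]`, and its orbit is a simple
curve: no self-intersections and no equilibrium points. -/
structure IsSimpleOrbit {N : ℕ} (P : EuclideanSpace ℝ (Fin N) → EuclideanSpace ℝ (Fin N))
    (x₀ : EuclideanSpace ℝ (Fin N)) (T : ℝ) (x : ℝ → EuclideanSpace ℝ (Fin N)) : Prop where
  solves : IsIntegralCurveOn x (fun _ => P) (Icc 0 T)
  initial : x 0 = x₀
  simple : InjOn x (Icc 0 T)
  regular : ∀ t ∈ Icc 0 T, P (x t) ≠ 0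

/-- `γ` is a trajectory of `ẋ = P(x)` during the open time interval `(c, d)`, staying in `U`. -/
def IsTrajectoryIn {N : ℕ} (P : EuclideanSpace ℝ (Fin N) → EuclideanSpace ℝ (Fin N))
    (U : Set (EuclideanSpace ℝ (Fin N))) (γ : ℝ → EuclideanSpace ℝ (Fin N)) (c d : ℝ) : Prop :=
  IsIntegralCurveOn γ (fun _ => P) (Ioo c d) ∧ MapsTo γ (Ioo c d) U

/-- `F` is a coordinate system on the open set `U`: a `C¹` diffeomorphism of `U` onto an open
subset of `ℝᴺ`. -/
def IsCoordinateSystem {N : ℕ}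
    (F : OpenPartialHomeomorph (EuclideanSpace ℝ (Fin N)) (EuclideanSpace ℝ (Fin N)))
    (U : Set (EuclideanSpace ℝ (Fin N))) : Prop :=
  F.source = U ∧ ContDiffOn ℝ 1 F F.source ∧ ContDiffOn ℝ 1 F.symm F.target

/-- `U` is a regular neighborhood of the set `K` (an orbit) for `ẋ = P(x)`: it is open, contains
`K` and no equilibrium, and is foliated by parallel orbit curves. That is, a single chart maps `U`
onto a ruled box (an interval in direction `i₀`, times a cube) and sends the orbit curves in `U` to
the lines `z_j = const`, `j ≠ i₀`. -/
def IsRegularNeighborhood {N : ℕ}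
    (P : EuclideanSpace ℝ (Fin N) → EuclideanSpace ℝ (Fin N))
    (K U : Set (EuclideanSpace ℝ (Fin N))) : Prop :=
  IsOpen U ∧ K ⊆ U ∧ (∀ p ∈ U, P p ≠ 0) ∧
    ∃ (ψ : OpenPartialHomeomorph (EuclideanSpace ℝ (Fin N)) (EuclideanSpace ℝ (Fin N)))
      (i₀ : Fin N) (a b ε : ℝ),
      a < b ∧ 0 < ε ∧ IsCoordinateSystem ψ U ∧
      ψ.target = {z | z i₀ ∈ Ioo a b ∧ ∀ j, j ≠ i₀ → |z j| < ε} ∧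
      ∀ (γ : ℝ → EuclideanSpace ℝ (Fin N)) (c d : ℝ), IsTrajectoryIn P U γ c d →
        ∀ j, j ≠ i₀ → ∀ s ∈ Ioo c d, ∀ t ∈ Ioo c d, ψ (γ s) j = ψ (γ t) j

/-- The vector field `Q(y) = (q₁(y₁), …, q_N(y_N))`. -/
def splitField {N : ℕ} (q : Fin N → ℝ → ℝ) (y : EuclideanSpace ℝ (Fin N)) :
    EuclideanSpace ℝ (Fin N) :=
  WithLp.toLp 2 (fun i => q i (y i))

/-- The dynamic `ẋ = P(x)` is split on `U`: there are coordinates `y = F(x)` on `U` with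
nonsingular Jacobian in which the dynamic becomes `ẏ_i = q_i(y_i)`, `i = 1, …, N`; each `q_i` is
continuous on the range of the coordinate `y_i`. -/
def IsSplitOn {N : ℕ} (P : EuclideanSpace ℝ (Fin N) → EuclideanSpace ℝ (Fin N))
    (U : Set (EuclideanSpace ℝ (Fin N))) : Prop :=
  ∃ (F : OpenPartialHomeomorph (EuclideanSpace ℝ (Fin N)) (EuclideanSpace ℝ (Fin N)))
    (q : Fin N → ℝ → ℝ),
    IsCoordinateSystem F U ∧
    (∀ p ∈ U, (fderiv ℝ F p).det ≠ 0) ∧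
    (∀ i, ContinuousOn (q i) ((fun p => F p i) '' U)) ∧
    ∀ (γ : ℝ → EuclideanSpace ℝ (Fin N)) (c d : ℝ), MapsTo γ (Ioo c d) U →
      (IsIntegralCurveOn γ (fun _ => P) (Ioo c d) ↔
        IsIntegralCurveOn (fun t => F (γ t)) (fun _ => splitField q) (Ioo c d))

/-! In coordinates where the field is the constant vector `e_{i₀}` the dynamic is already split,
with every `q_i` equal to the constant 0 or 1. So splitting means straightening the field on the
whole neighborhood by a C¹ change of variables.

Existence of regular neighborhoods: cut `P` off outside a ball containing the orbit, so that its
flow `φ` is complete and jointly C¹. Pick `i₀` with `P(x₀)_{i₀} ≠ 0` and send `z` to the point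
reached after time `z_{i₀}` from the hyperplane point with the other coordinates of `z` (`flowOut`).
This map has invertible derivative along the segment `[0,T]e_{i₀}` and is injective there because
the orbit is simple. Compactness gives injectivity near the segment, hence a chart on a thin ruled
box (`exists_flowBox`).

Splitting on a given regular neighborhood: in its chart `ψ` the field is `v e_{i₀}` with `v`
nonvanishing, and one wants to replace `z_{i₀}` by elapsed time, the fibre integral of `1/v`. The
difficulty is that `ψ` is only C¹, so `v` is only continuous, and the integral has no evident
derivative in the transverse directions. But the time coordinate of a small flow box, read in the
chart `ψ`, is a local C¹ primitive of `1/v`. Chaining these along a fibre shows that the global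
integral is C¹ (`isPrimitiveAt_fiberIntegral`). -/

/-! ### Differentiability of superposition operators on spaces of continuous maps. -/

section Superposition

open Topology

variable {X E F : Type*} [TopologicalSpace X] [CompactSpace X]
  [NormedAddCommGroup E] [NormedSpace ℝ E] [NormedAddCommGroup F] [NormedSpace ℝ F]

/-- Pointwise application of a continuous family of continuous linear maps. -/
noncomputable def ContinuousMap.pointwiseApply :
    C(X, E →L[ℝ] F) →L[ℝ] C(X, E) →L[ℝ] C(X, F) :=
  LinearMap.mkContinuous₂
    (LinearMap.mk₂ ℝ (fun (A : C(X, E →L[ℝ] F)) (b : C(X, E)) =>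
        (⟨fun x => A x (b x), by fun_prop⟩ : C(X, F)))
      (fun A B b => by ext; simp) (fun c A b => by ext; simp)
      (fun A b b' => by ext; simp) (fun c A b => by ext; simp)) 1
    (fun A b => by
      rw [one_mul, ContinuousMap.norm_le _ (by positivity)]
      intro x
      exact (A x).le_of_opNorm_le_of_le (A.norm_coe_le_norm x) (b.norm_coe_le_norm x))

/-- The superposition operator `α ↦ f ∘ α` on continuous maps is differentiable if `f` is `C¹`
with uniformly continuous derivative. -/
theorem ContinuousMap.hasFDerivAt_comp {f : E → F} (hf : ContDiff ℝ 1 f)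
    (hu : UniformContinuous (fderiv ℝ f)) (α : C(X, E)) :
    HasFDerivAt (fun α : C(X, E) => (⟨f, hf.continuous⟩ : C(E, F)).comp α)
      (ContinuousMap.pointwiseApply ((⟨fderiv ℝ f, hu.continuous⟩ : C(E, E →L[ℝ] F)).comp α)) α := by
  rw [hasFDerivAt_iff_isLittleO_nhds_zero, Asymptotics.isLittleO_iff]
  intro c hc
  obtain ⟨δ, hδ, H⟩ := Metric.uniformContinuous_iff.1 hu c hc
  filter_upwards [Metric.ball_mem_nhds (0 : C(X, E)) hδ] with h hh
  rw [ContinuousMap.norm_le _ (by positivity)]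
  intro x
  have hhx : ‖h x‖ < δ := (h.norm_coe_le_norm x).trans_lt (by simpa using hh)
  -- Mean value inequality on a ball whose radius `δ` does not depend on `x`; this is where uniform
  -- continuity of the derivative enters.
  have key := Convex.norm_image_sub_le_of_norm_fderiv_le' (𝕜 := ℝ) (f := f)
    (s := Metric.ball (α x) δ) (C := c) (φ := fderiv ℝ f (α x)) (x := α x) (y := α x + h x)
    (fun y _ => (hf.differentiable one_ne_zero) y)
    (fun y hy => by rw [← dist_eq_norm]; exact (H hy).le)
    (convex_ball _ _) (Metric.mem_ball_self hδ) (by simpa using hhx)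
  have h2 : ‖f (α x + h x) - f (α x) - (fderiv ℝ f (α x)) (h x)‖ ≤ c * ‖h x‖ := by
    simpa using key
  exact h2.trans (mul_le_mul_of_nonneg_left (h.norm_coe_le_norm x) hc.le)

theorem ContinuousMap.contDiff_comp {f : E → F} (hf : ContDiff ℝ 1 f)
    (hu : UniformContinuous (fderiv ℝ f)) :
    ContDiff ℝ 1 (fun α : C(X, E) => (⟨f, hf.continuous⟩ : C(E, F)).comp α) := by
  rw [contDiff_one_iff_hasFDerivAt]
  refine ⟨_, ?_, fun α => ContinuousMap.hasFDerivAt_comp hf hu α⟩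
  exact ContinuousMap.pointwiseApply.continuous.comp (ContinuousMap.continuous_postcomp _)

end Superposition

/-! ### Joint C¹ regularity of flows, by the implicit function theorem on the Picard equation. -/

section Flow

open Filter Topology NNReal unitInterval

variable {E : Type*} [NormedAddCommGroup E] [NormedSpace ℝ E]

/-- The Volterra operator `β ↦ ∫₀ᶿ β` on continuous curves. -/
noncomputable def volterra : C(I, E) →L[ℝ] C(I, E) :=
  LinearMap.mkContinuous
    { toFun := fun β => ⟨fun θ => ∫ r in (0 : ℝ)..θ, IccExtend zero_le_one β r,
        (intervalIntegral.continuous_primitive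
          (fun a b => (β.continuous.Icc_extend').intervalIntegrable a b) 0).comp
          continuous_subtype_val⟩
      map_add' := fun β β' => by
        ext θ
        exact intervalIntegral.integral_add (β.continuous.Icc_extend'.intervalIntegrable _ _)
          (β'.continuous.Icc_extend'.intervalIntegrable _ _)
      map_smul' := fun c β => by
        ext θ
        exact intervalIntegral.integral_smul c _ } 1
    (fun β => by
      rw [one_mul, ContinuousMap.norm_le _ (by positivity)]
      intro θ
      have := intervalIntegral.norm_integral_le_of_norm_le_const (a := 0) (b := (θ : ℝ)) (C := ‖β‖)
        (f := IccExtend zero_le_one β) (fun r _ => β.norm_coe_le_norm _)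
      refine this.trans ?_
      rw [sub_zero, abs_of_nonneg θ.2.1]
      exact mul_le_of_le_one_right (norm_nonneg _) θ.2.2)

theorem norm_volterra_apply_le (β : C(I, E)) : ‖volterra β‖ ≤ ‖β‖ := by
  simpa using (LinearMap.mkContinuous_norm_le _ zero_le_one _ : ‖(volterra : C(I, E) →L[ℝ] _)‖ ≤ 1)
    |> (volterra : C(I, E) →L[ℝ] C(I, E)).le_of_opNorm_le (x := β)

variable {f : E → E} {K : ℝ≥0}

/-- The Picard equation `α(θ) - x - s ∫₀ᶿ f(α) = 0`, whose solution is `θ ↦ φ(s θ, x)`. -/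
noncomputable def picardDefect (hf : Continuous f) (p : (ℝ × E) × C(I, E)) : C(I, E) :=
  p.2 - ContinuousMap.const I p.1.2 - p.1.1 • volterra ((⟨f, hf⟩ : C(E, E)).comp p.2)

theorem contDiff_picardDefect (hf : ContDiff ℝ 1 f) (hu : UniformContinuous (fderiv ℝ f)) :
    ContDiff ℝ 1 (picardDefect hf.continuous) := by
  have h1 : ContDiff ℝ 1 (fun p : (ℝ × E) × C(I, E) => ContinuousMap.const I p.1.2) :=
    (ContinuousLinearMap.const ℝ I : E →L[ℝ] C(I, E)).contDiff.comp (by fun_prop)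
  have h2 : ContDiff ℝ 1 (fun p : (ℝ × E) × C(I, E) =>
      volterra ((⟨f, hf.continuous⟩ : C(E, E)).comp p.2)) :=
    volterra.contDiff.comp ((ContinuousMap.contDiff_comp hf hu).comp contDiff_snd)
  exact (contDiff_snd.sub h1).sub
    ((by fun_prop : ContDiff ℝ 1 fun p : (ℝ × E) × C(I, E) => p.1.1).smul h2)

theorem picardDefect_eq_zero [CompleteSpace E] (hf : Continuous f) {x : E} {γ : ℝ → E} (h0 : γ 0 = x)
    (hγ : IsIntegralCurve γ (fun _ => f)) (s : ℝ) :
    picardDefect hf ((s, x), ⟨fun θ => γ (s * θ), by have := hγ.continuous; fun_prop⟩) = 0 := by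
  have hc := hγ.continuous
  ext θ
  have h1 : ∀ r ∈ uIcc (0 : ℝ) θ, HasDerivAt (fun r => γ (s * r)) (s • f (γ (s * r))) r := by
    intro r _
    simpa [Function.comp_def] using (hγ (s * r)).scomp r ((hasDerivAt_id r).const_mul s)
  have h2 := intervalIntegral.integral_eq_sub_of_hasDerivAt h1
    (Continuous.intervalIntegrable (by fun_prop) _ _)
  rw [intervalIntegral.integral_smul] at h2
  have h3 : ∫ r in (0 : ℝ)..θ, f (γ (s * r)) = ∫ r in (0 : ℝ)..θ, IccExtend zero_le_one
      (fun θ : I => f (γ (s * θ))) r := by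
    refine intervalIntegral.integral_congr fun r hr => ?_
    rw [uIcc_of_le θ.2.1] at hr
    exact (IccExtend_of_mem zero_le_one (fun θ : I => f (γ (s * θ))) ⟨hr.1, hr.2.trans θ.2.2⟩).symm
  rw [h3] at h2
  simp only [mul_zero, h0] at h2
  change γ (s * θ) - x - s • _ = 0
  rw [sub_eq_zero, ← h2]
  rfl

/-- For `|s| K < 1` the Picard map is a contraction of all of `C(I, E)`. Since uniqueness is global,
no continuity of the flow in the initial point is needed before applying the implicit function
theorem. -/
theorem picardDefect_unique (hf : LipschitzWith K f) {s : ℝ} (hs : |s| * K < 1) {x : E}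
    {α β : C(I, E)} (hα : picardDefect hf.continuous ((s, x), α) = 0)
    (hβ : picardDefect hf.continuous ((s, x), β) = 0) : α = β := by
  set N : C(I, E) → C(I, E) := fun α => (⟨f, hf.continuous⟩ : C(E, E)).comp α with hN
  have h1 : α - β = s • volterra (N α - N β) := by
    have hα' : α - ContinuousMap.const I x - s • volterra (N α) = 0 := hα
    have hβ' : β - ContinuousMap.const I x - s • volterra (N β) = 0 := hβ
    rw [map_sub, smul_sub, ← sub_eq_zero, ← sub_eq_zero.2 (hα'.trans hβ'.symm)]
    abel
  have h2 : ‖N α - N β‖ ≤ K * ‖α - β‖ := by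
    rw [ContinuousMap.norm_le _ (by positivity)]
    intro θ
    refine (hf.norm_sub_le (α θ) (β θ)).trans ?_
    exact mul_le_mul_of_nonneg_left ((α - β).norm_coe_le_norm θ) K.2
  have h3 : ‖α - β‖ ≤ |s| * K * ‖α - β‖ := by
    nth_rw 1 [h1]
    rw [norm_smul, Real.norm_eq_abs, mul_assoc]
    exact mul_le_mul_of_nonneg_left ((norm_volterra_apply_le _).trans h2) (abs_nonneg s)
  have h4 : ‖α - β‖ = 0 := by
    by_contra h
    have : 0 < ‖α - β‖ := lt_of_le_of_ne (norm_nonneg _) (Ne.symm h)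
    nlinarith
  exact sub_eq_zero.1 (norm_eq_zero.1 h4)

/-- The partial derivative in the curve variable is `1 - s V A`, with `V` the Volterra operator and
`A` multiplication by `Df(α)`. Its perturbation has norm at most `|s| K < 1`, so a Neumann series
inverts it. -/
theorem isInvertible_fderiv_picardDefect [CompleteSpace E] (hf : ContDiff ℝ 1 f)
    (hu : UniformContinuous (fderiv ℝ f)) (hK : LipschitzWith K f) {s : ℝ} (hs : |s| * K < 1)
    (x : E) (α : C(I, E)) :
    (fderiv ℝ (picardDefect hf.continuous) ((s, x), α) ∘L
      .inr ℝ (ℝ × E) C(I, E)).IsInvertible := by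
  set A : C(I, E) →L[ℝ] C(I, E) :=
    ContinuousMap.pointwiseApply ((⟨fderiv ℝ f, hu.continuous⟩ : C(E, E →L[ℝ] E)).comp α) with hA
  have h1 : HasFDerivAt (fun β => picardDefect hf.continuous ((s, x), β))
      (ContinuousLinearMap.id ℝ _ - s • (volterra ∘L A)) α := by
    have := (volterra.hasFDerivAt (x := (⟨f, hf.continuous⟩ : C(E, E)).comp α)).comp α
      (ContinuousMap.hasFDerivAt_comp hf hu α)
    exact ((hasFDerivAt_id α).sub_const (ContinuousMap.const I x)).sub (this.const_smul s)
  have h2 : fderiv ℝ (picardDefect hf.continuous) ((s, x), α) ∘L .inr ℝ (ℝ × E) C(I, E)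
      = ContinuousLinearMap.id ℝ _ - s • (volterra ∘L A) := by
    refine HasFDerivAt.unique (f := fun β => picardDefect hf.continuous ((s, x), β)) ?_ h1
    exact (((contDiff_picardDefect hf hu).differentiable one_ne_zero) _).hasFDerivAt.comp α
      (hasFDerivAt_prodMk_right (s, x) α)
  have hnA : ‖A‖ ≤ K := by
    refine ContinuousLinearMap.opNorm_le_bound _ K.2 fun β => ?_
    rw [ContinuousMap.norm_le _ (by positivity)]
    intro θ
    exact (fderiv ℝ f (α θ)).le_of_opNorm_le_of_le (norm_fderiv_le_of_lipschitz ℝ hK)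
      (β.norm_coe_le_norm θ)
  have h3 : ‖s • (volterra ∘L A)‖ < 1 := by
    refine lt_of_le_of_lt (ContinuousLinearMap.opNorm_le_bound _ (by positivity) fun β => ?_) hs
    change ‖s • volterra (A β)‖ ≤ _
    rw [norm_smul, Real.norm_eq_abs, mul_assoc]
    exact mul_le_mul_of_nonneg_left
      ((norm_volterra_apply_le _).trans (A.le_of_opNorm_le hnA β)) (abs_nonneg s)
  rw [h2]
  obtain ⟨u, hu'⟩ := isUnit_one_sub_of_norm_lt_one (R := C(I, E) →L[ℝ] C(I, E)) h3
  exact ⟨ContinuousLinearEquiv.unitsEquiv ℝ _ u, hu'⟩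

/-- The implicit function is a C¹ family of solutions of the Picard equation; by uniqueness it is
the family of rescaled flow curves, and evaluation at `θ = 1` recovers the flow. -/
theorem contDiffAt_flow_of_small [CompleteSpace E] (hf : ContDiff ℝ 1 f)
    (hu : UniformContinuous (fderiv ℝ f))
    (hK : LipschitzWith K f) {φ : ℝ → E → E} (h0 : ∀ x, φ 0 x = x)
    (hφ : ∀ x, IsIntegralCurve (fun t => φ t x) (fun _ => f)) {s : ℝ} (hs : |s| * K < 1) (x : E) :
    ContDiffAt ℝ 1 (fun p : ℝ × E => φ p.1 p.2) (s, x) := by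
  set α : ℝ × E → C(I, E) := fun p =>
    ⟨fun θ => φ (p.1 * θ) p.2, by have := (hφ p.2).continuous; fun_prop⟩ with hα
  have hz : ∀ p, picardDefect hf.continuous (p, α p) = 0 := fun p =>
    picardDefect_eq_zero hf.continuous (h0 p.2) (hφ p.2) p.1
  have cd : ContDiffAt ℝ 1 (picardDefect hf.continuous) ((s, x), α (s, x)) :=
    (contDiff_picardDefect hf hu).contDiffAt
  have hinv := isInvertible_fderiv_picardDefect hf hu hK hs x (α (s, x))
  have hψ : ContDiffAt ℝ 1 (cd.implicitFunction one_ne_zero hinv) (s, x) :=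
    cd.contDiffAt_implicitFunction one_ne_zero hinv
  have hev : ∀ᶠ p in 𝓝 (s, x), picardDefect hf.continuous
      (p, cd.implicitFunction one_ne_zero hinv p) = 0 := by
    filter_upwards [cd.eventually_apply_implicitFunction one_ne_zero hinv] with p hp
    rw [hp, hz]
  have hsm : ∀ᶠ p : ℝ × E in 𝓝 (s, x), |p.1| * K < 1 :=
    (by fun_prop : Continuous fun p : ℝ × E => |p.1| * (K : ℝ)).continuousAt.eventually_lt_const hs
  have heq : (fun p : ℝ × E => φ p.1 p.2) =ᶠ[𝓝 (s, x)]
      fun p => ContinuousMap.evalCLM ℝ (1 : I) (cd.implicitFunction one_ne_zero hinv p) := by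
    filter_upwards [hev, hsm] with p hp hp'
    rw [picardDefect_unique hK hp' hp (hz p)]
    simp [hα]
  refine ContDiffAt.congr_of_eventuallyEq ?_ heq
  exact (ContinuousMap.evalCLM ℝ (1 : I)).contDiff.contDiffAt.comp (s, x) hψ

theorem IsIntegralCurve.eq_of_lipschitzWith (hK : LipschitzWith K f) {γ γ' : ℝ → E}
    (hγ : IsIntegralCurve γ (fun _ => f)) (hγ' : IsIntegralCurve γ' (fun _ => f)) (h0 : γ 0 = γ' 0) :
    γ = γ' :=
  ODE_solution_unique_univ (v := fun _ => f) (s := fun _ => univ) (K := K) (t₀ := 0)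
    (fun _ => hK.lipschitzOnWith) (fun t => ⟨hγ t, trivial⟩) (fun t => ⟨hγ' t, trivial⟩) h0

theorem flow_add (hK : LipschitzWith K f) {φ : ℝ → E → E} (h0 : ∀ x, φ 0 x = x)
    (hφ : ∀ x, IsIntegralCurve (fun t => φ t x) (fun _ => f)) (s t : ℝ) (x : E) :
    φ (s + t) x = φ s (φ t x) := by
  have := IsIntegralCurve.eq_of_lipschitzWith hK ((hφ x).comp_add t) (hφ (φ t x))
    (by simp [h0])
  exact congrFun this s

/-- The flow of a globally Lipschitz `C¹` vector field is jointly `C¹`. -/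
theorem contDiff_flow [CompleteSpace E] (hf : ContDiff ℝ 1 f) (hu : UniformContinuous (fderiv ℝ f))
    (hK : LipschitzWith K f) {φ : ℝ → E → E} (h0 : ∀ x, φ 0 x = x)
    (hφ : ∀ x, IsIntegralCurve (fun t => φ t x) (fun _ => f)) :
    ContDiff ℝ 1 (fun p : ℝ × E => φ p.1 p.2) := by
  -- The admissible time range doubles at each step, since `φ_s = φ_{s/2} ∘ φ_{s/2}`.
  have key : ∀ n : ℕ, ∀ s : ℝ, |s| * K < 2 ^ n → ∀ x,
      ContDiffAt ℝ 1 (fun p : ℝ × E => φ p.1 p.2) (s, x) := by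
    intro n
    induction n with
    | zero => intro s hs x; exact contDiffAt_flow_of_small hf hu hK h0 hφ (by simpa using hs) x
    | succ n ih =>
      intro s hs x
      have hs' : |s / 2| * K < 2 ^ n := by
        rw [abs_div, abs_two]; rw [pow_succ] at hs; linarith
      have heq : (fun p : ℝ × E => φ p.1 p.2) =
          (fun p : ℝ × E => φ p.1 p.2) ∘ fun p => (p.1 / 2, φ (p.1 / 2) p.2) := by
        ext p
        simp only [Function.comp]
        rw [← flow_add hK h0 hφ, add_halves]
      rw [heq]
      have h1 : ContDiffAt ℝ 1 (fun p : ℝ × E => φ (p.1 / 2) p.2) (s, x) :=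
        (ih (s / 2) hs' x).comp (s, x) (f := fun p : ℝ × E => (p.1 / 2, p.2))
          (by fun_prop)
      exact (ih (s / 2) hs' _).comp (s, x) ((by fun_prop : ContDiffAt ℝ 1
        (fun p : ℝ × E => p.1 / 2) (s, x)).prodMk h1)
  rw [contDiff_iff_contDiffAt]
  rintro ⟨s, x⟩
  obtain ⟨n, hn⟩ := pow_unbounded_of_one_lt (|s| * K) (one_lt_two : (1 : ℝ) < 2)
  exact key n s hn x

/-- A bounded globally Lipschitz vector field has global integral curves. -/
theorem exists_isIntegralCurve_of_lipschitzWith [CompleteSpace E] (hK : LipschitzWith K f) {L : ℝ≥0}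
    (hL : ∀ x, ‖f x‖ ≤ L) (x : E) : ∃ γ : ℝ → E, γ 0 = x ∧ IsIntegralCurve γ (fun _ => f) := by
  have hex : ∀ n : ℕ, ∃ α : ℝ → E, α 0 = x ∧
      ∀ t ∈ Ioo (-(n + 1 : ℝ)) (n + 1), HasDerivAt α (f (α t)) t := by
    intro n
    have h0 : (0 : ℝ) ∈ Icc (-(n + 1 : ℝ)) (n + 1) :=
      ⟨by linarith [n.cast_nonneg (α := ℝ)], by positivity⟩
    -- A curve of speed at most `L` travels at most `L (n + 1)` in time `n + 1`, so this radius puts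
    -- no restriction on the time interval.
    have hPL : IsPicardLindelof (fun _ => f) (⟨0, h0⟩ : Icc (-(n + 1 : ℝ)) (n + 1)) x
        (L * (n + 1)) 0 L K :=
      { lipschitzOnWith := fun _ _ => hK.lipschitzOnWith
        continuousOn := fun _ _ => continuousOn_const
        norm_le := fun _ _ y _ => hL y
        mul_max_le := by simp }
    obtain ⟨α, hα, h⟩ := hPL.exists_eq_forall_mem_Icc_hasDerivWithinAt₀
    exact ⟨α, hα, fun t ht => (h t (Ioo_subset_Icc_self ht)).hasDerivAt (Icc_mem_nhds ht.1 ht.2)⟩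
  choose α hα0 hα using hex
  have hmono : ∀ m n : ℕ, m ≤ n → EqOn (α m) (α n) (Ioo (-(m + 1 : ℝ)) (m + 1)) := by
    intro m n hmn
    have hmn' : (m : ℝ) ≤ n := by exact_mod_cast hmn
    refine ODE_solution_unique_of_mem_Ioo (v := fun _ => f) (s := fun _ => univ) (K := K) (t₀ := 0)
      (fun _ _ => hK.lipschitzOnWith) ⟨by linarith [m.cast_nonneg (α := ℝ)], by positivity⟩
      (fun t ht => ⟨hα m t ht, trivial⟩)
      (fun t ht => ⟨hα n t ⟨by linarith [ht.1], by linarith [ht.2]⟩, trivial⟩) ?_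
    rw [hα0, hα0]
  -- The curve of index `n` lives on `(-(n+1), n+1)`, so index `⌈|t|⌉₊` contains `t` strictly; near
  -- `t` one further index covers all neighbouring choices.
  refine ⟨fun t => α ⌈|t|⌉₊ t, by simp [hα0], fun t => ?_⟩
  have hloc : (fun t => α ⌈|t|⌉₊ t) =ᶠ[𝓝 t] α (⌈|t|⌉₊ + 1) := by
    have hev : ∀ᶠ r in 𝓝 t, |r| < |t| + 1 :=
      continuous_abs.continuousAt.eventually_lt_const (by linarith)
    filter_upwards [hev] with r hr
    refine hmono _ _ ?_ ⟨?_, ?_⟩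
    · rw [Nat.ceil_le]; push_cast; linarith [Nat.le_ceil |t|]
    · have := Nat.le_ceil |r|; linarith [neg_abs_le r]
    · have := Nat.le_ceil |r|; linarith [le_abs_self r]
  have hval := hloc.self_of_nhds
  rw [hval]
  refine (hα _ t ⟨?_, ?_⟩).congr_of_eventuallyEq hloc
  · have := Nat.le_ceil |t|; push_cast; linarith [neg_abs_le t]
  · have := Nat.le_ceil |t|; push_cast; linarith [le_abs_self t]

/-- A compactly supported `C¹` vector field has a complete flow, which is jointly `C¹`. -/
theorem exists_contDiff_flow [CompleteSpace E] (hf : ContDiff ℝ 1 f) (hc : HasCompactSupport f) :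
    ∃ φ : ℝ → E → E, (∀ x, φ 0 x = x) ∧
      (∀ x, IsIntegralCurve (fun t => φ t x) (fun _ => f)) ∧
      (∀ s t x, φ (s + t) x = φ s (φ t x)) ∧
      ContDiff ℝ 1 (fun p : ℝ × E => φ p.1 p.2) := by
  obtain ⟨K, hK⟩ := hf.lipschitzWith_of_hasCompactSupport hc one_ne_zero
  obtain ⟨L, hL⟩ := hf.continuous.bounded_above_of_compact_support hc
  have hu : UniformContinuous (fderiv ℝ f) :=
    (hc.fderiv ℝ).uniformContinuous_of_continuous (hf.continuous_fderiv one_ne_zero)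
  choose φ h0 hφ using exists_isIntegralCurve_of_lipschitzWith hK (L := L.toNNReal)
    (fun x => (hL x).trans (Real.le_coe_toNNReal L))
  exact ⟨fun t x => φ x t, h0, hφ, flow_add hK h0 hφ, contDiff_flow hf hu hK h0 hφ⟩

end Flow

/-! ### Calculus of coordinate systems and transport of integral curves. -/

section CoordinateSystem

open Filter Topology

variable {N : ℕ}

theorem ContinuousLinearMap.exists_equiv_of_injective {E : Type*} [NormedAddCommGroup E]
    [NormedSpace ℝ E] [FiniteDimensional ℝ E] {A : E →L[ℝ] E} (hA : Function.Injective A) :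
    ∃ e : E ≃L[ℝ] E, (e : E →L[ℝ] E) = A :=
  ⟨(LinearEquiv.ofInjectiveEndo (A : E →ₗ[ℝ] E) hA).toContinuousLinearEquiv, by ext; rfl⟩

theorem IsCoordinateSystem.symm
    {F : OpenPartialHomeomorph (EuclideanSpace ℝ (Fin N)) (EuclideanSpace ℝ (Fin N))}
    {U : Set (EuclideanSpace ℝ (Fin N))} (hF : IsCoordinateSystem F U) :
    IsCoordinateSystem F.symm F.target :=
  ⟨rfl, hF.2.2, hF.2.1⟩

theorem IsCoordinateSystem.isOpen
    {F : OpenPartialHomeomorph (EuclideanSpace ℝ (Fin N)) (EuclideanSpace ℝ (Fin N))}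
    {U : Set (EuclideanSpace ℝ (Fin N))} (hF : IsCoordinateSystem F U) : IsOpen U :=
  hF.1 ▸ F.open_source

theorem IsCoordinateSystem.contDiffAt
    {F : OpenPartialHomeomorph (EuclideanSpace ℝ (Fin N)) (EuclideanSpace ℝ (Fin N))}
    {U : Set (EuclideanSpace ℝ (Fin N))} (hF : IsCoordinateSystem F U)
    {p : EuclideanSpace ℝ (Fin N)} (hp : p ∈ U) : ContDiffAt ℝ 1 F p := by
  rw [← hF.1] at hp
  exact hF.2.1.contDiffAt (F.open_source.mem_nhds hp)

theorem IsCoordinateSystem.exists_equiv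
    {F : OpenPartialHomeomorph (EuclideanSpace ℝ (Fin N)) (EuclideanSpace ℝ (Fin N))}
    {U : Set (EuclideanSpace ℝ (Fin N))} (hF : IsCoordinateSystem F U)
    {p : EuclideanSpace ℝ (Fin N)} (hp : p ∈ U) :
    ∃ e : EuclideanSpace ℝ (Fin N) ≃L[ℝ] EuclideanSpace ℝ (Fin N),
      HasFDerivAt F (e : EuclideanSpace ℝ (Fin N) →L[ℝ] EuclideanSpace ℝ (Fin N)) p ∧
      HasFDerivAt F.symm (e.symm : EuclideanSpace ℝ (Fin N) →L[ℝ] EuclideanSpace ℝ (Fin N))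
        (F p) := by
  have hps : p ∈ F.source := hF.1.symm ▸ hp
  have h1 := ((hF.contDiffAt hp).differentiableAt one_ne_zero).hasFDerivAt
  have h2 := ((hF.symm.contDiffAt (F.map_source hps)).differentiableAt one_ne_zero).hasFDerivAt
  have h3 : HasFDerivAt F.symm (fderiv ℝ F.symm (F p)) (F p) := h2
  have h4 : HasFDerivAt id (fderiv ℝ F.symm (F p) ∘L fderiv ℝ F p) p := by
    refine (h3.comp p h1).congr_of_eventuallyEq ?_
    filter_upwards [F.open_source.mem_nhds hps] with q hq
    exact (F.left_inv hq).symm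
  have h5 := h4.unique (hasFDerivAt_id p)
  have hinj : Function.Injective (fderiv ℝ F p) := fun v w hvw => by
    have hv := congrArg (fun A => A v) h5
    have hw := congrArg (fun A => A w) h5
    simp only [ContinuousLinearMap.comp_apply, ContinuousLinearMap.id_apply] at hv hw
    rw [← hv, ← hw, hvw]
  obtain ⟨e, he⟩ := ContinuousLinearMap.exists_equiv_of_injective hinj
  refine ⟨e, by rw [he]; exact h1, ?_⟩
  have h6 : (e.symm : EuclideanSpace ℝ (Fin N) →L[ℝ] EuclideanSpace ℝ (Fin N)) =
      fderiv ℝ F.symm (F p) := by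
    ext1 v
    have := congrArg (fun A => A (e.symm v)) h5
    simpa [← he] using this.symm
  rw [h6]
  exact h3

theorem IsCoordinateSystem.det_fderiv_ne_zero
    {F : OpenPartialHomeomorph (EuclideanSpace ℝ (Fin N)) (EuclideanSpace ℝ (Fin N))}
    {U : Set (EuclideanSpace ℝ (Fin N))} (hF : IsCoordinateSystem F U)
    {p : EuclideanSpace ℝ (Fin N)} (hp : p ∈ U) : (fderiv ℝ F p).det ≠ 0 := by
  obtain ⟨e, he, -⟩ := hF.exists_equiv hp
  rw [he.fderiv]
  exact (LinearEquiv.isUnit_det' e.toLinearEquiv).ne_zero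

theorem IsCoordinateSystem.trans
    {F G : OpenPartialHomeomorph (EuclideanSpace ℝ (Fin N)) (EuclideanSpace ℝ (Fin N))}
    {U : Set (EuclideanSpace ℝ (Fin N))} (hF : IsCoordinateSystem F U)
    (hG : IsCoordinateSystem G F.target) : IsCoordinateSystem (F.trans G) U := by
  have hsrc : (F.trans G).source = U := by
    rw [F.trans_source, hG.1, ← hF.1]
    exact inter_eq_left.2 F.mapsTo
  refine ⟨hsrc, ?_, ?_⟩
  · rw [hsrc, ← hF.1]
    exact hG.2.1.comp hF.2.1 fun p hp => hG.1.ge (F.map_source hp)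
  · refine hF.2.2.comp (hG.2.2.mono ?_) ?_
    · rw [F.trans_target]; exact inter_subset_left
    · rw [F.trans_target]; exact fun y hy => hy.2

/-- An injective `C¹` map with injective derivatives on an open set is a coordinate system. -/
theorem exists_coordinateSystem_of_injOn {G : EuclideanSpace ℝ (Fin N) → EuclideanSpace ℝ (Fin N)}
    {B : Set (EuclideanSpace ℝ (Fin N))} (hB : IsOpen B) (hG : ContDiffOn ℝ 1 G B)
    (hinj : InjOn G B) (hd : ∀ z ∈ B, Function.Injective (fderiv ℝ G z)) :
    ∃ F : OpenPartialHomeomorph (EuclideanSpace ℝ (Fin N)) (EuclideanSpace ℝ (Fin N)),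
      ⇑F = G ∧ F.target = G '' B ∧ IsCoordinateSystem F B := by
  have hloc : ∀ z ∈ B, ∃ e : EuclideanSpace ℝ (Fin N) ≃L[ℝ] EuclideanSpace ℝ (Fin N),
      HasStrictFDerivAt G (e : EuclideanSpace ℝ (Fin N) →L[ℝ] EuclideanSpace ℝ (Fin N)) z := by
    intro z hz
    obtain ⟨e, he⟩ := ContinuousLinearMap.exists_equiv_of_injective (hd z hz)
    exact ⟨e, he ▸ (hG.contDiffAt (hB.mem_nhds hz)).hasStrictFDerivAt one_ne_zero⟩
  -- Openness, from the inverse function theorem at each point, is what makes the global inverse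
  -- continuous.
  have hopen : IsOpenMap (B.domRestrict G) := by
    rw [isOpenMap_iff_nhds_le]
    rintro ⟨z, hz⟩
    obtain ⟨e, he⟩ := hloc z hz
    have h1 : B.domRestrict G = G ∘ Subtype.val := rfl
    rw [h1, ← Filter.map_map, map_nhds_subtype_coe_eq_nhds hz (hB.mem_nhds hz)]
    exact he.map_nhds_eq_of_equiv.ge
  let F := OpenPartialHomeomorph.ofContinuousOpenRestrict hinj.toPartialEquiv
    hG.continuousOn hopen hB
  refine ⟨F, rfl, rfl, rfl, hG, fun y hy => ?_⟩
  have hy' : F.symm y ∈ B := F.map_target hy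
  obtain ⟨e, he⟩ := hloc _ hy'
  exact (F.contDiffAt_symm hy he.hasFDerivAt (hG.contDiffAt (hB.mem_nhds hy'))).contDiffWithinAt

theorem isIntegralCurveOn_Ioo_iff {E : Type*} [NormedAddCommGroup E] [NormedSpace ℝ E]
    {γ : ℝ → E} {v : ℝ → E → E} {c d : ℝ} :
    IsIntegralCurveOn γ v (Ioo c d) ↔ ∀ t ∈ Ioo c d, HasDerivAt γ (v t (γ t)) t :=
  ⟨fun h t ht => (h t ht).hasDerivAt (Ioo_mem_nhds ht.1 ht.2),
    fun h t ht => (h t ht).hasDerivWithinAt⟩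

/-- A coordinate system that pushes the field `P` forward to `Q` transforms the integral curves of
`P` into those of `Q`. -/
theorem IsCoordinateSystem.isIntegralCurveOn_iff
    {F : OpenPartialHomeomorph (EuclideanSpace ℝ (Fin N)) (EuclideanSpace ℝ (Fin N))}
    {U : Set (EuclideanSpace ℝ (Fin N))} (hF : IsCoordinateSystem F U)
    {P Q : EuclideanSpace ℝ (Fin N) → EuclideanSpace ℝ (Fin N)}
    (hPQ : ∀ p ∈ U, fderiv ℝ F p (P p) = Q (F p))
    {γ : ℝ → EuclideanSpace ℝ (Fin N)} {c d : ℝ} (hγ : MapsTo γ (Ioo c d) U) :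
    IsIntegralCurveOn γ (fun _ => P) (Ioo c d) ↔
      IsIntegralCurveOn (fun t => F (γ t)) (fun _ => Q) (Ioo c d) := by
  rw [isIntegralCurveOn_Ioo_iff, isIntegralCurveOn_Ioo_iff]
  refine forall₂_congr fun t ht => ?_
  obtain ⟨e, he, he'⟩ := hF.exists_equiv (hγ ht)
  have hQ : Q (F (γ t)) = e (P (γ t)) := by rw [← hPQ _ (hγ ht), he.fderiv]; rfl
  rw [hQ]
  constructor
  · intro h
    exact he.comp_hasDerivAt t h
  · intro h
    have h1 := he'.comp_hasDerivAt t h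
    simp only [ContinuousLinearEquiv.coe_coe, ContinuousLinearEquiv.symm_apply_apply] at h1
    refine h1.congr_of_eventuallyEq ?_
    filter_upwards [Ioo_mem_nhds ht.1 ht.2] with r hr
    exact (F.left_inv (hF.1.symm ▸ hγ hr)).symm

end CoordinateSystem

/-! ### Flow boxes along a whole simple orbit. -/

section FlowBox

open Filter Topology

variable {N : ℕ}

/-- The ruled box: an interval in direction `i₀`, times a cube. -/
def ruledBox (i₀ : Fin N) (a b ε : ℝ) : Set (EuclideanSpace ℝ (Fin N)) :=
  {z | z i₀ ∈ Ioo a b ∧ ∀ j, j ≠ i₀ → |z j| < ε}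

theorem isOpen_ruledBox (i₀ : Fin N) (a b ε : ℝ) : IsOpen (ruledBox i₀ a b ε) := by
  have : ruledBox i₀ a b ε = (fun z : EuclideanSpace ℝ (Fin N) => z i₀) ⁻¹' Ioo a b ∩
      ⋂ j, ⋂ (_ : j ≠ i₀), {z | |z j| < ε} := by
    ext z; simp [ruledBox]
  rw [this]
  refine (isOpen_Ioo.preimage (by fun_prop)).inter ?_
  refine isOpen_iInter_of_finite fun j => isOpen_iInter_of_finite fun _ => ?_
  exact isOpen_lt (by fun_prop) continuous_const

/-- The projection that kills the coordinate `i₀`. -/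
noncomputable def killCoord (i₀ : Fin N) :
    EuclideanSpace ℝ (Fin N) →L[ℝ] EuclideanSpace ℝ (Fin N) :=
  ContinuousLinearMap.id ℝ _ -
    (EuclideanSpace.proj i₀ : EuclideanSpace ℝ (Fin N) →L[ℝ] ℝ).smulRight
      (EuclideanSpace.single i₀ (1 : ℝ))

theorem killCoord_apply (i₀ : Fin N) (z : EuclideanSpace ℝ (Fin N)) :
    killCoord i₀ z = z - z i₀ • EuclideanSpace.single i₀ (1 : ℝ) := rfl

theorem killCoord_self (i₀ : Fin N) (z : EuclideanSpace ℝ (Fin N)) : killCoord i₀ z i₀ = 0 := by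
  simp [killCoord_apply]

theorem killCoord_single (i₀ : Fin N) :
    killCoord i₀ (EuclideanSpace.single i₀ (1 : ℝ)) = 0 := by
  simp [killCoord_apply]

/-- Small boxes around a segment in direction `i₀` lie in any neighborhood of the segment. -/
theorem exists_ruledBox_subset {i₀ : Fin N} {T : ℝ} (hT : 0 ≤ T)
    {W : Set (EuclideanSpace ℝ (Fin N))} (hW : IsOpen W)
    (hKW : (fun t : ℝ => t • EuclideanSpace.single i₀ (1 : ℝ)) '' Icc 0 T ⊆ W) :
    ∃ ε > 0, ruledBox i₀ (-ε) (T + ε) ε ⊆ W := by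
  have hK : IsCompact ((fun t : ℝ => t • EuclideanSpace.single i₀ (1 : ℝ)) '' Icc 0 T) :=
    isCompact_Icc.image (by fun_prop)
  obtain ⟨δ, hδ, hsub⟩ := hK.exists_thickening_subset_open hW hKW
  have hcont : Continuous (fun v : Fin N → ℝ => (WithLp.toLp 2 v : EuclideanSpace ℝ (Fin N))) :=
    PiLp.continuous_toLp 2 _
  obtain ⟨ε, hε, H⟩ := Metric.continuousAt_iff.1 (hcont.continuousAt (x := 0)) δ hδ
  refine ⟨ε, hε, fun z hz => hsub ?_⟩
  rw [Metric.mem_thickening_iff]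
  -- The comparison point on the segment has height `z i₀` clamped to `[0, T]`; all coordinates of
  -- the difference are then below `ε`.
  refine ⟨_, ⟨max 0 (min (z i₀) T), ⟨le_max_left _ _, max_le hT (min_le_right _ _)⟩, rfl⟩, ?_⟩
  have h1 : ∀ w : EuclideanSpace ℝ (Fin N), (∀ j, |w j| < ε) → ‖w‖ < δ := by
    intro w hw
    have := @H (w.ofLp) (by rw [dist_zero_right, pi_norm_lt_iff hε]; exact hw)
    simpa using this
  rw [dist_eq_norm]
  refine h1 _ fun j => ?_
  by_cases hj : j = i₀
  · subst hj
    have := hz.1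
    simp only [PiLp.sub_apply, PiLp.smul_apply, PiLp.single_apply, if_true, smul_eq_mul, mul_one,
      abs_lt]
    rcases le_total (z j) T with h | h <;> rcases le_total 0 (z j) with h' | h' <;>
      simp [h, h', hT] <;> first | exact hε | (constructor <;> linarith [this.1, this.2])
  · simpa [hj] using hz.2 j hj

theorem exists_truncation {P : EuclideanSpace ℝ (Fin N) → EuclideanSpace ℝ (Fin N)}
    (hP : ContDiff ℝ 1 P) (R : ℝ) :
    ∃ f : EuclideanSpace ℝ (Fin N) → EuclideanSpace ℝ (Fin N),
      ContDiff ℝ 1 f ∧ HasCompactSupport f ∧ EqOn f P (Metric.ball 0 R) := by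
  let χ : ContDiffBump (0 : EuclideanSpace ℝ (Fin N)) :=
    ⟨max R 1, max R 1 + 1, by positivity, by linarith⟩
  refine ⟨fun p => χ p • P p, χ.contDiff.smul hP, χ.hasCompactSupport.smul_right, fun p hp => ?_⟩
  have : χ p = 1 := χ.one_of_mem_closedBall
    (Metric.ball_subset_closedBall (Metric.ball_subset_ball (le_max_left _ _) hp))
  simp [this]

/-- The flow-out of the hyperplane through `x₀` orthogonal to the direction `i₀`. -/
noncomputable def flowOut (φ : ℝ → EuclideanSpace ℝ (Fin N) → EuclideanSpace ℝ (Fin N))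
    (x₀ : EuclideanSpace ℝ (Fin N)) (i₀ : Fin N) (z : EuclideanSpace ℝ (Fin N)) :
    EuclideanSpace ℝ (Fin N) :=
  φ (z i₀) (x₀ + killCoord i₀ z)

variable {f : EuclideanSpace ℝ (Fin N) → EuclideanSpace ℝ (Fin N)}
  {φ : ℝ → EuclideanSpace ℝ (Fin N) → EuclideanSpace ℝ (Fin N)}
  {x₀ : EuclideanSpace ℝ (Fin N)} {i₀ : Fin N}

theorem contDiff_flowOut (hφ1 : ContDiff ℝ 1 (fun p : ℝ × EuclideanSpace ℝ (Fin N) => φ p.1 p.2)) :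
    ContDiff ℝ 1 (flowOut φ x₀ i₀) := by
  have h1 : ContDiff ℝ 1 (fun z : EuclideanSpace ℝ (Fin N) => z i₀) := by fun_prop
  exact hφ1.comp (h1.prodMk (contDiff_const.add (killCoord i₀).contDiff))

theorem flowOut_smul_single (t : ℝ) :
    flowOut φ x₀ i₀ (t • EuclideanSpace.single i₀ (1 : ℝ)) = φ t x₀ := by
  simp [flowOut, killCoord_single]

theorem flowOut_add_smul_single (z : EuclideanSpace ℝ (Fin N)) (r : ℝ) :
    flowOut φ x₀ i₀ (z + r • EuclideanSpace.single i₀ (1 : ℝ)) =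
      φ (z i₀ + r) (x₀ + killCoord i₀ z) := by
  simp [flowOut, killCoord_single]

theorem fderiv_flowOut_single
    (hφ : ∀ x, IsIntegralCurve (fun t => φ t x) (fun _ => f))
    (hφ1 : ContDiff ℝ 1 (fun p : ℝ × EuclideanSpace ℝ (Fin N) => φ p.1 p.2))
    (z : EuclideanSpace ℝ (Fin N)) :
    fderiv ℝ (flowOut φ x₀ i₀) z (EuclideanSpace.single i₀ 1) = f (flowOut φ x₀ i₀ z) := by
  have h1 := ((contDiff_flowOut (x₀ := x₀) (i₀ := i₀) hφ1).differentiable one_ne_zero z).hasFDerivAt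
    |>.hasLineDerivAt (EuclideanSpace.single i₀ (1 : ℝ))
  have h2 : HasDerivAt (fun r : ℝ => φ (z i₀ + r) (x₀ + killCoord i₀ z))
      (f (flowOut φ x₀ i₀ z)) 0 := by
    have := (hφ (x₀ + killCoord i₀ z) (z i₀ + 0)).comp_const_add (z i₀) 0
    simpa [flowOut] using this
  have h3 : HasDerivAt (fun r : ℝ => flowOut φ x₀ i₀ (z + r • EuclideanSpace.single i₀ (1 : ℝ)))
      (f (flowOut φ x₀ i₀ z)) 0 := by
    simpa only [flowOut_add_smul_single] using h2
  exact HasDerivAt.unique h1 h3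

theorem fderiv_flow_zero (h0 : ∀ x, φ 0 x = x)
    (hφ : ∀ x, IsIntegralCurve (fun t => φ t x) (fun _ => f))
    (hφ1 : ContDiff ℝ 1 (fun p : ℝ × EuclideanSpace ℝ (Fin N) => φ p.1 p.2))
    (x : EuclideanSpace ℝ (Fin N)) (s : ℝ) (w : EuclideanSpace ℝ (Fin N)) :
    fderiv ℝ (fun p : ℝ × EuclideanSpace ℝ (Fin N) => φ p.1 p.2) (0, x) (s, w) = s • f x + w := by
  have hd := (hφ1.differentiable one_ne_zero (0, x)).hasFDerivAt
  have h1 : HasDerivAt (fun t : ℝ => φ t x)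
      (fderiv ℝ (fun p : ℝ × EuclideanSpace ℝ (Fin N) => φ p.1 p.2) (0, x) (1, 0)) 0 :=
    hd.comp_hasDerivAt (f := fun t : ℝ => (t, x)) (0 : ℝ)
      ((hasDerivAt_id (0 : ℝ)).prodMk (hasDerivAt_const _ x))
  have h2 : HasFDerivAt (fun y : EuclideanSpace ℝ (Fin N) => φ 0 y)
      (fderiv ℝ (fun p : ℝ × EuclideanSpace ℝ (Fin N) => φ p.1 p.2) (0, x) ∘L
        ContinuousLinearMap.inr ℝ ℝ _) x :=
    hd.comp x (hasFDerivAt_prodMk_right (0 : ℝ) x)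
  have h3 := h1.unique (hφ x 0)
  have h4 := h2.unique (((hasFDerivAt_id x).congr_of_eventuallyEq
    (Eventually.of_forall fun y => h0 y)))
  have h5 := congrArg (fun A => A w) h4
  simp only [ContinuousLinearMap.comp_apply, ContinuousLinearMap.inr_apply,
    ContinuousLinearMap.id_apply] at h5
  simp only [h0] at h3
  have h6 : ((s, w) : ℝ × EuclideanSpace ℝ (Fin N)) = s • (1, 0) + (0, w) := by simp
  rw [h6, map_add, map_smul, h3, h5]

/-- The derivative sends `v` to `v_{i₀} f(x₀)` plus the transverse part of `v`. Its `i₀` coordinate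
is `v_{i₀} f(x₀)_{i₀}`, so transversality of the hyperplane to the field gives a trivial kernel. -/
theorem injective_fderiv_flowOut_zero (h0 : ∀ x, φ 0 x = x)
    (hφ : ∀ x, IsIntegralCurve (fun t => φ t x) (fun _ => f))
    (hφ1 : ContDiff ℝ 1 (fun p : ℝ × EuclideanSpace ℝ (Fin N) => φ p.1 p.2))
    (hi₀ : f x₀ i₀ ≠ 0) : Function.Injective (fderiv ℝ (flowOut φ x₀ i₀) 0) := by
  have hx : ((0 : EuclideanSpace ℝ (Fin N)) i₀, x₀ + killCoord i₀ 0) = ((0 : ℝ), x₀) := by simp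
  have hd : HasFDerivAt (fun p : ℝ × EuclideanSpace ℝ (Fin N) => φ p.1 p.2)
      (fderiv ℝ (fun p : ℝ × EuclideanSpace ℝ (Fin N) => φ p.1 p.2) (0, x₀))
      ((0 : EuclideanSpace ℝ (Fin N)) i₀, x₀ + killCoord i₀ 0) := by
    rw [hx]; exact (hφ1.differentiable one_ne_zero (0, x₀)).hasFDerivAt
  have h1 : HasFDerivAt (fun z : EuclideanSpace ℝ (Fin N) => (z i₀, x₀ + killCoord i₀ z))
      ((EuclideanSpace.proj i₀ : EuclideanSpace ℝ (Fin N) →L[ℝ] ℝ).prod (killCoord i₀)) 0 :=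
    (EuclideanSpace.proj i₀ : EuclideanSpace ℝ (Fin N) →L[ℝ] ℝ).hasFDerivAt.prodMk
      ((killCoord i₀).hasFDerivAt.const_add x₀)
  have h2 : HasFDerivAt (flowOut φ x₀ i₀) _ 0 :=
    hd.comp (f := fun z : EuclideanSpace ℝ (Fin N) => (z i₀, x₀ + killCoord i₀ z)) 0 h1
  rw [h2.fderiv, injective_iff_map_eq_zero]
  intro v hv
  have hv' : v i₀ • f x₀ + killCoord i₀ v = 0 := by
    rw [← fderiv_flow_zero h0 hφ hφ1]; exact hv
  have hvi : v i₀ = 0 := by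
    have := congrArg (fun w : EuclideanSpace ℝ (Fin N) => w i₀) hv'
    simpa [killCoord_self, hi₀] using this
  rw [hvi, zero_smul, zero_add, killCoord_apply, hvi, zero_smul, sub_zero] at hv'
  exact hv'

/-- Flowing back by time `t` carries the flow-out near `t e_{i₀}` to the flow-out near `0`. By the
chain rule the injective derivative at `0` factors through the derivative at `t e_{i₀}`. -/
theorem injective_fderiv_flowOut (h0 : ∀ x, φ 0 x = x)
    (hφ : ∀ x, IsIntegralCurve (fun t => φ t x) (fun _ => f))
    (hadd : ∀ s t x, φ (s + t) x = φ s (φ t x))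
    (hφ1 : ContDiff ℝ 1 (fun p : ℝ × EuclideanSpace ℝ (Fin N) => φ p.1 p.2))
    (hi₀ : f x₀ i₀ ≠ 0) (t : ℝ) :
    Function.Injective
      (fderiv ℝ (flowOut φ x₀ i₀) (t • EuclideanSpace.single i₀ (1 : ℝ))) := by
  set e := EuclideanSpace.single i₀ (1 : ℝ) with he
  have hG := (contDiff_flowOut (x₀ := x₀) (i₀ := i₀) hφ1).differentiable one_ne_zero
  have hφt : Differentiable ℝ (fun y => φ (-t) y) :=
    (hφ1.comp (contDiff_const.prodMk contDiff_id)).differentiable one_ne_zero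
  have heq : (fun z => flowOut φ x₀ i₀ (z - t • e)) = fun z => φ (-t) (flowOut φ x₀ i₀ z) := by
    ext1 z
    have := flowOut_add_smul_single (φ := φ) (x₀ := x₀) (i₀ := i₀) z (-t)
    rw [neg_smul, ← sub_eq_add_neg] at this
    rw [this, add_comm, hadd]
    rfl
  have h1 : HasFDerivAt (fun z => flowOut φ x₀ i₀ (z - t • e))
      (fderiv ℝ (flowOut φ x₀ i₀) 0) (t • e) := by
    have hG0 : HasFDerivAt (flowOut φ x₀ i₀) (fderiv ℝ (flowOut φ x₀ i₀) 0) (t • e - t • e) := by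
      rw [sub_self]; exact (hG 0).hasFDerivAt
    exact hG0.comp (f := fun z => z - t • e) (t • e)
      ((hasFDerivAt_id (t • e)).sub_const (t • e))
  rw [heq] at h1
  have h2 := h1.unique ((hφt _).hasFDerivAt.comp (t • e) (hG (t • e)).hasFDerivAt)
  have h3 := injective_fderiv_flowOut_zero h0 hφ hφ1 hi₀
  rw [h2] at h3
  exact Function.Injective.of_comp (f := fderiv ℝ (fun y => φ (-t) y) (flowOut φ x₀ i₀ (t • e))) h3

theorem ContDiff.eventually_injective_fderiv {E : Type*} [NormedAddCommGroup E]
    [NormedSpace ℝ E] [FiniteDimensional ℝ E] {G : E → E} {z : E} (hG : ContDiff ℝ 1 G)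
    (hz : Function.Injective (fderiv ℝ G z)) :
    ∀ᶠ w in 𝓝 z, Function.Injective (fderiv ℝ G w) := by
  have := FiniteDimensional.complete ℝ E
  obtain ⟨e, he⟩ := ContinuousLinearMap.exists_equiv_of_injective hz
  have h1 := (hG.continuous_fderiv one_ne_zero).continuousAt (x := z)
  have h2 := h1.eventually (he ▸ ContinuousLinearEquiv.nhds e)
  filter_upwards [h2] with w hw
  obtain ⟨e', he'⟩ := hw
  rw [← he']
  exact e'.injective

/-- Around every simple orbit there is a coordinate system onto a ruled box in which the vector
field is constant. -/
theorem exists_flowBox {P : EuclideanSpace ℝ (Fin N) → EuclideanSpace ℝ (Fin N)}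
    (hP : ContDiff ℝ 1 P) {T : ℝ} (hT : 0 ≤ T) {x : ℝ → EuclideanSpace ℝ (Fin N)}
    (hx : IsSimpleOrbit P x₀ T x) {O : Set (EuclideanSpace ℝ (Fin N))} (hO : IsOpen O)
    (hxO : x '' Icc 0 T ⊆ O) :
    ∃ (ψ : OpenPartialHomeomorph (EuclideanSpace ℝ (Fin N)) (EuclideanSpace ℝ (Fin N)))
      (i₀ : Fin N) (a b ε : ℝ), a < b ∧ 0 < ε ∧ ψ.source ⊆ O ∧ x '' Icc 0 T ⊆ ψ.source ∧
      IsCoordinateSystem ψ ψ.source ∧ ψ.target = ruledBox i₀ a b ε ∧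
      ∀ p ∈ ψ.source, P p ≠ 0 ∧ fderiv ℝ ψ p (P p) = EuclideanSpace.single i₀ 1 := by
  have h0mem : (0 : ℝ) ∈ Icc 0 T := ⟨le_rfl, hT⟩
  have hxc : ContinuousOn x (Icc 0 T) := hx.solves.continuousOn
  obtain ⟨R, hR⟩ := (isCompact_Icc.image_of_continuousOn hxc).isBounded.subset_ball 0
  obtain ⟨f, hf, hfc, hfP⟩ := exists_truncation hP R
  obtain ⟨φ, h0, hφ, hadd, hφ1⟩ := exists_contDiff_flow hf hfc
  have hxR : ∀ t ∈ Icc 0 T, x t ∈ Metric.ball 0 R := fun t ht => hR (mem_image_of_mem x ht)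
  have hfx : ∀ t ∈ Icc 0 T, f (x t) = P (x t) := fun t ht => hfP (hxR t ht)
  have hx₀ : f x₀ ≠ 0 := by rw [← hx.initial, hfx 0 h0mem]; exact hx.regular 0 h0mem
  obtain ⟨i₀, hi₀⟩ : ∃ i₀, f x₀ i₀ ≠ 0 := by
    by_contra! h
    exact hx₀ (by ext i; exact h i)
  obtain ⟨K, hK⟩ := hf.lipschitzWith_of_hasCompactSupport hfc one_ne_zero
  -- The orbit stays in the ball where the truncated field equals `P`, so it is also an orbit of the
  -- complete flow.
  have hφx : EqOn x (fun t => φ t x₀) (Icc 0 T) := by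
    refine ODE_solution_unique (v := fun _ => f) (K := K) (fun _ => hK) hxc (fun t ht => ?_)
      (hφ x₀).continuous.continuousOn (fun t _ => (hφ x₀ t).hasDerivWithinAt) ?_
    · have h1 : HasDerivWithinAt x (P (x t)) (Icc 0 T) t := hx.solves t (Ico_subset_Icc_self ht)
      rw [← hfx t (Ico_subset_Icc_self ht)] at h1
      refine h1.mono_of_mem_nhdsWithin ?_
      exact mem_of_superset (Icc_mem_nhdsGE ht.2) (Icc_subset_Icc_left ht.1)
    · simp [h0, hx.initial]
  set G := flowOut φ x₀ i₀ with hG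
  have hGc : ContDiff ℝ 1 G := contDiff_flowOut hφ1
  set S := (fun t : ℝ => t • (EuclideanSpace.single i₀ (1 : ℝ) : EuclideanSpace ℝ (Fin N))) ''
    Icc 0 T with hS
  have hGS : ∀ t ∈ Icc 0 T, G (t • EuclideanSpace.single i₀ (1 : ℝ)) = x t := fun t ht => by
    rw [hG, flowOut_smul_single, hφx ht]
  have hSc : IsCompact S := isCompact_Icc.image (by fun_prop)
  have hinjS : InjOn G S := by
    rintro _ ⟨s, hs, rfl⟩ _ ⟨t, ht, rfl⟩ h
    simp only at h ⊢
    rw [hGS s hs, hGS t ht] at h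
    rw [hx.simple hs ht h]
  have hd : ∀ z ∈ S, Function.Injective (fderiv ℝ G z) := by
    rintro _ ⟨t, -, rfl⟩
    exact injective_fderiv_flowOut h0 hφ hadd hφ1 hi₀ t
  -- Injective on a compact set and locally injective at each of its points implies injective on a
  -- neighborhood of it.
  obtain ⟨V, hV, hVinj⟩ := hinjS.exists_mem_nhdsSet hSc (fun z _ => hGc.continuous.continuousAt)
    (fun z hz => by
      obtain ⟨e, he⟩ := ContinuousLinearMap.exists_equiv_of_injective (hd z hz)
      have hs : HasStrictFDerivAt G (e : EuclideanSpace ℝ (Fin N) →L[ℝ] _) z :=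
        he ▸ hGc.contDiffAt.hasStrictFDerivAt one_ne_zero
      exact ⟨_, (hs.toOpenPartialHomeomorph G).open_source.mem_nhds
        hs.mem_toOpenPartialHomeomorph_source, (hs.toOpenPartialHomeomorph G).injOn⟩)
  have hev : ∀ᶠ z in 𝓝ˢ S, z ∈ V ∧ Function.Injective (fderiv ℝ G z) ∧ G z ∈ O ∧
      G z ∈ Metric.ball 0 R ∧ P (G z) ≠ 0 := by
    refine Filter.Eventually.and hV (eventually_nhdsSet_iff_forall.2 ?_)
    rintro z hz
    have hc : ContinuousAt G z := hGc.continuous.continuousAt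
    obtain ⟨t, ht, rfl⟩ := hz
    have hmem := mem_image_of_mem (fun t : ℝ => t • (EuclideanSpace.single i₀ (1 : ℝ) :
      EuclideanSpace ℝ (Fin N))) ht
    refine (ContDiff.eventually_injective_fderiv hGc (hd _ hmem)).and
      ((hc.eventually_mem (hO.mem_nhds ?_)).and
      ((hc.eventually_mem (Metric.isOpen_ball.mem_nhds ?_)).and
        ((hP.continuous.continuousAt.comp hc).eventually_ne ?_)))
    · rw [hGS t ht]; exact hxO (mem_image_of_mem x ht)
    · rw [hGS t ht]; exact hxR t ht
    · simp only [Function.comp]; rw [hGS t ht]; exact hx.regular t ht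
  obtain ⟨W, hWo, hSW, hW⟩ := eventually_nhdsSet_iff_exists.1 hev
  obtain ⟨ε, hε, hB⟩ := exists_ruledBox_subset hT hWo hSW
  obtain ⟨F, hFG, hFt, hF⟩ := exists_coordinateSystem_of_injOn
    (isOpen_ruledBox i₀ (-ε) (T + ε) ε) hGc.contDiffOn
    (hVinj.mono fun z hz => (hW z (hB hz)).1) (fun z hz => (hW z (hB hz)).2.1)
  have hpt : ∀ p ∈ F.target, ∃ z ∈ ruledBox i₀ (-ε) (T + ε) ε, F z = p := fun p hp => by
    rw [hFt] at hp
    obtain ⟨z, hz, rfl⟩ := hp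
    exact ⟨z, hz, by rw [hFG]⟩
  refine ⟨F.symm, i₀, -ε, T + ε, ε, by linarith, hε, ?_, ?_, hF.symm, hF.1, ?_⟩
  · intro p hp
    obtain ⟨z, hz, rfl⟩ := hpt p hp
    rw [hFG]
    exact (hW z (hB hz)).2.2.1
  · rintro _ ⟨t, ht, rfl⟩
    change x t ∈ F.target
    rw [hFt, ← hGS t ht]
    refine mem_image_of_mem _ ⟨?_, fun j hj => ?_⟩
    · simp only [PiLp.smul_apply, PiLp.single_apply, if_true, smul_eq_mul, mul_one]
      exact ⟨by linarith [ht.1], by linarith [ht.2]⟩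
    · simpa [hj] using hε
  · intro p hp
    obtain ⟨z, hz, rfl⟩ := hpt p hp
    obtain ⟨e, he, he'⟩ := hF.exists_equiv hz
    have h1 := fderiv_flowOut_single (x₀ := x₀) (i₀ := i₀) hφ hφ1 z
    rw [← hG, ← hFG, he.fderiv, hFG, hfP (hW z (hB hz)).2.2.2.1] at h1
    rw [he'.fderiv, hFG]
    refine ⟨(hW z (hB hz)).2.2.2.2, ?_⟩
    rw [← h1]
    exact e.symm_apply_apply _

theorem IsRegularNeighborhood.of_flowBox
    {P : EuclideanSpace ℝ (Fin N) → EuclideanSpace ℝ (Fin N)} {S : Set (EuclideanSpace ℝ (Fin N))}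
    {ψ : OpenPartialHomeomorph (EuclideanSpace ℝ (Fin N)) (EuclideanSpace ℝ (Fin N))}
    {a b ε : ℝ} (hab : a < b) (hε : 0 < ε) (hS : S ⊆ ψ.source)
    (hψ : IsCoordinateSystem ψ ψ.source) (ht : ψ.target = ruledBox i₀ a b ε)
    (h : ∀ p ∈ ψ.source, P p ≠ 0 ∧ fderiv ℝ ψ p (P p) = EuclideanSpace.single i₀ 1) :
    IsRegularNeighborhood P S ψ.source := by
  refine ⟨ψ.open_source, hS, fun p hp => (h p hp).1, ψ, i₀, a, b, ε, hab, hε, hψ, ht, ?_⟩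
  intro γ c d hγ j hj s hs t ht
  have h1 := (hψ.isIntegralCurveOn_iff (Q := fun _ => EuclideanSpace.single i₀ 1)
    (fun p hp => (h p hp).2) hγ.2).1 hγ.1
  rw [isIntegralCurveOn_Ioo_iff] at h1
  have h2 : ∀ r ∈ Ioo c d, HasDerivAt (fun r => ψ (γ r) j) 0 r := by
    intro r hr
    have := (EuclideanSpace.proj j : EuclideanSpace ℝ (Fin N) →L[ℝ] ℝ).hasFDerivAt.comp_hasDerivAt
      r (h1 r hr)
    simpa [hj, Function.comp_def] using this
  exact isOpen_Ioo.is_const_of_deriv_eq_zero isPreconnected_Ioo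
    (fun r hr => (h2 r hr).differentiableAt.differentiableWithinAt)
    (fun r hr => (h2 r hr).deriv) hs ht

end FlowBox

/-! ### Straightening the field on a regular neighborhood. -/

section Splitting

open Filter Topology

variable {N : ℕ} {i₀ : Fin N} {a b ε : ℝ}

theorem killCoord_add_smul_single (z : EuclideanSpace ℝ (Fin N)) :
    killCoord i₀ z + z i₀ • EuclideanSpace.single i₀ (1 : ℝ) = z := by
  simp [killCoord_apply]

theorem killCoord_add_smul_apply_self (z : EuclideanSpace ℝ (Fin N)) (r : ℝ) :
    (killCoord i₀ z + r • EuclideanSpace.single i₀ (1 : ℝ)) i₀ = r := by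
  simp [killCoord_self]

theorem killCoord_add_smul_single_eq (z : EuclideanSpace ℝ (Fin N)) (r : ℝ) :
    killCoord i₀ (z + r • EuclideanSpace.single i₀ (1 : ℝ)) = killCoord i₀ z := by
  simp [killCoord_single]

theorem killCoord_killCoord (z : EuclideanSpace ℝ (Fin N)) :
    killCoord i₀ (killCoord i₀ z) = killCoord i₀ z := by
  rw [killCoord_apply i₀ (killCoord i₀ z), killCoord_self, zero_smul, sub_zero]

theorem killCoord_add_smul_mem_ruledBox {z : EuclideanSpace ℝ (Fin N)}
    (hz : z ∈ ruledBox i₀ a b ε) {r : ℝ} (hr : r ∈ Ioo a b) :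
    killCoord i₀ z + r • EuclideanSpace.single i₀ (1 : ℝ) ∈ ruledBox i₀ a b ε := by
  refine ⟨?_, fun j hj => ?_⟩
  · rwa [killCoord_add_smul_apply_self]
  · simpa [killCoord_apply, hj] using hz.2 j hj

/-- `t` is a `C¹` primitive of `h` in direction `i₀` at the point `z`. -/
def IsPrimitiveAt (i₀ : Fin N) (h t : EuclideanSpace ℝ (Fin N) → ℝ)
    (z : EuclideanSpace ℝ (Fin N)) : Prop :=
  ContDiffAt ℝ 1 t z ∧ fderiv ℝ t z (EuclideanSpace.single i₀ 1) = h z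

theorem IsPrimitiveAt.hasDerivAt {h t : EuclideanSpace ℝ (Fin N) → ℝ}
    {z : EuclideanSpace ℝ (Fin N)} {r : ℝ}
    (ht : IsPrimitiveAt i₀ h t (killCoord i₀ z + r • EuclideanSpace.single i₀ (1 : ℝ))) :
    HasDerivAt (fun r : ℝ => t (killCoord i₀ z + r • EuclideanSpace.single i₀ (1 : ℝ)))
      (h (killCoord i₀ z + r • EuclideanSpace.single i₀ (1 : ℝ))) r := by
  rw [← ht.2]
  have h1 : HasDerivAt (fun r : ℝ => killCoord i₀ z + r • EuclideanSpace.single i₀ (1 : ℝ))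
      (EuclideanSpace.single i₀ (1 : ℝ)) r := by
    simpa using ((hasDerivAt_id r).smul_const (EuclideanSpace.single i₀ (1 : ℝ))).const_add
      (killCoord i₀ z)
  exact (ht.1.differentiableAt one_ne_zero).hasFDerivAt.comp_hasDerivAt r h1

theorem intervalIntegrable_fiber {h : EuclideanSpace ℝ (Fin N) → ℝ}
    (hc : ContinuousOn h (ruledBox i₀ a b ε)) {z : EuclideanSpace ℝ (Fin N)}
    (hz : z ∈ ruledBox i₀ a b ε) {s s' : ℝ} (hs : s ∈ Ioo a b) (hs' : s' ∈ Ioo a b) :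
    IntervalIntegrable (fun r => h (killCoord i₀ z + r • EuclideanSpace.single i₀ (1 : ℝ)))
      MeasureTheory.volume s s' := by
  refine ContinuousOn.intervalIntegrable ?_
  refine hc.comp (by fun_prop) fun r hr => killCoord_add_smul_mem_ruledBox hz ?_
  exact (ordConnected_Ioo.uIcc_subset hs hs') hr

/-- The integral of `h` over the fibre in direction `i₀`, from `z_{i₀} = c`. -/
noncomputable def fiberIntegral (i₀ : Fin N) (c : ℝ) (h : EuclideanSpace ℝ (Fin N) → ℝ)
    (z : EuclideanSpace ℝ (Fin N)) : ℝ :=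
  ∫ r in c..z i₀, h (killCoord i₀ z + r • EuclideanSpace.single i₀ (1 : ℝ))

theorem exists_local_primitive {h : EuclideanSpace ℝ (Fin N) → ℝ}
    (hc : ContinuousOn h (ruledBox i₀ a b ε))
    (hprim : ∀ z ∈ ruledBox i₀ a b ε, ∃ t, ∀ᶠ w in 𝓝 z, IsPrimitiveAt i₀ h t w)
    {z₀ : EuclideanSpace ℝ (Fin N)} (hz₀ : z₀ ∈ ruledBox i₀ a b ε) {s : ℝ} (hs : s ∈ Ioo a b) :
    ∃ t : EuclideanSpace ℝ (Fin N) → ℝ, ∃ η > 0, ∀ z ∈ Metric.ball z₀ η,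
      z ∈ ruledBox i₀ a b ε ∧ ∀ r ∈ Metric.ball s η, r ∈ Ioo a b ∧
        IsPrimitiveAt i₀ h t (killCoord i₀ z + r • EuclideanSpace.single i₀ (1 : ℝ)) ∧
        ∀ r' ∈ Metric.ball s η,
          ∫ r in r..r', h (killCoord i₀ z + r • EuclideanSpace.single i₀ (1 : ℝ)) =
            t (killCoord i₀ z + r' • EuclideanSpace.single i₀ (1 : ℝ)) -
              t (killCoord i₀ z + r • EuclideanSpace.single i₀ (1 : ℝ)) := by
  obtain ⟨t, ht⟩ := hprim _ (killCoord_add_smul_mem_ruledBox hz₀ hs)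
  have hcont : Continuous (fun q : EuclideanSpace ℝ (Fin N) × ℝ =>
      killCoord i₀ q.1 + q.2 • EuclideanSpace.single i₀ (1 : ℝ)) := by fun_prop
  have h1 := (hcont.continuousAt (x := (z₀, s))).eventually ht
  have h2 : ∀ᶠ q : EuclideanSpace ℝ (Fin N) × ℝ in 𝓝 (z₀, s),
      q.1 ∈ ruledBox i₀ a b ε ∧ q.2 ∈ Ioo a b :=
    (continuousAt_fst.eventually_mem ((isOpen_ruledBox i₀ a b ε).mem_nhds hz₀)).and
      (continuousAt_snd.eventually_mem (isOpen_Ioo.mem_nhds hs))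
  obtain ⟨η, hη, H⟩ := Metric.eventually_nhds_iff_ball.1 (h1.and h2)
  have H' : ∀ z ∈ Metric.ball z₀ η, ∀ r ∈ Metric.ball s η,
      IsPrimitiveAt i₀ h t (killCoord i₀ z + r • EuclideanSpace.single i₀ (1 : ℝ)) ∧
        z ∈ ruledBox i₀ a b ε ∧ r ∈ Ioo a b := fun z hz r hr =>
    H (z, r) (by rw [← ball_prod_same]; exact ⟨hz, hr⟩)
  refine ⟨t, η, hη, fun z hz => ⟨(H' z hz s (Metric.mem_ball_self hη)).2.1, fun r hr =>
    ⟨(H' z hz r hr).2.2, (H' z hz r hr).1, fun r' hr' => ?_⟩⟩⟩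
  have hsub : uIcc r r' ⊆ Metric.ball s η := by
    rw [Real.ball_eq_Ioo] at hr hr' ⊢
    exact ordConnected_Ioo.uIcc_subset hr hr'
  exact intervalIntegral.integral_eq_sub_of_hasDerivAt
    (fun ρ hρ => (H' z hz ρ (hsub hρ)).1.hasDerivAt)
    (intervalIntegrable_fiber hc (H' z hz r hr).2.1 (H' z hz r hr).2.2 (H' z hz r' hr').2.2)

/-- Between nearby heights the integral is a difference of values of one local primitive, hence C¹
in `z`. Additivity then propagates this along the fibre. -/
theorem contDiffAt_integral_fiber {h : EuclideanSpace ℝ (Fin N) → ℝ}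
    (hc : ContinuousOn h (ruledBox i₀ a b ε))
    (hprim : ∀ z ∈ ruledBox i₀ a b ε, ∃ t, ∀ᶠ w in 𝓝 z, IsPrimitiveAt i₀ h t w)
    {z₀ : EuclideanSpace ℝ (Fin N)} (hz₀ : z₀ ∈ ruledBox i₀ a b ε) {s s' : ℝ}
    (hs : s ∈ Ioo a b) (hs' : s' ∈ Ioo a b) :
    ContDiffAt ℝ 1 (fun z : EuclideanSpace ℝ (Fin N) =>
      ∫ r in s..s', h (killCoord i₀ z + r • EuclideanSpace.single i₀ (1 : ℝ))) z₀ := by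
  -- Being C¹ at `z₀` is a symmetric, transitive relation between endpoints that holds locally,
  -- hence on the whole connected interval.
  refine isPreconnected_Ioo.induction₂ (fun s s' => ContDiffAt ℝ 1
    (fun z : EuclideanSpace ℝ (Fin N) =>
      ∫ r in s..s', h (killCoord i₀ z + r • EuclideanSpace.single i₀ (1 : ℝ))) z₀)
    ?_ ?_ ?_ hs hs'
  · intro s hs
    obtain ⟨t, η, hη, H⟩ := exists_local_primitive hc hprim hz₀ hs
    refine mem_nhdsWithin_of_mem_nhds ?_
    filter_upwards [Metric.ball_mem_nhds s hη] with s' hs'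
    have h1 : ∀ r ∈ Metric.ball s η, ContDiffAt ℝ 1 (fun z : EuclideanSpace ℝ (Fin N) =>
        t (killCoord i₀ z + r • EuclideanSpace.single i₀ (1 : ℝ))) z₀ := fun r hr =>
      ((H z₀ (Metric.mem_ball_self hη)).2 r hr).2.1.1.comp z₀
        (f := fun z => killCoord i₀ z + r • EuclideanSpace.single i₀ (1 : ℝ))
        ((killCoord i₀).contDiff.contDiffAt.add contDiffAt_const)
    refine ((h1 s' hs').sub (h1 s (Metric.mem_ball_self hη))).congr_of_eventuallyEq ?_
    filter_upwards [Metric.ball_mem_nhds z₀ hη] with z hz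
    exact ((H z hz).2 s (Metric.mem_ball_self hη)).2.2 s' hs'
  · intro s s' s'' hs hs' hs'' h1 h2
    refine (h1.add h2).congr_of_eventuallyEq ?_
    filter_upwards [(isOpen_ruledBox i₀ a b ε).mem_nhds hz₀] with z hz
    exact (intervalIntegral.integral_add_adjacent_intervals
      (intervalIntegrable_fiber hc hz hs hs') (intervalIntegrable_fiber hc hz hs' hs'')).symm
  · intro s s' _ _ h1
    refine h1.neg.congr_of_eventuallyEq (Eventually.of_forall fun z => ?_)
    exact intervalIntegral.integral_symm _ _

/-- If `h` has local `C¹` primitives in direction `i₀`, the fibre integral is a global one. -/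
theorem isPrimitiveAt_fiberIntegral {h : EuclideanSpace ℝ (Fin N) → ℝ}
    (hc : ContinuousOn h (ruledBox i₀ a b ε))
    (hprim : ∀ z ∈ ruledBox i₀ a b ε, ∃ t, ∀ᶠ w in 𝓝 z, IsPrimitiveAt i₀ h t w)
    {c : ℝ} (hcab : c ∈ Ioo a b) {z₀ : EuclideanSpace ℝ (Fin N)}
    (hz₀ : z₀ ∈ ruledBox i₀ a b ε) : IsPrimitiveAt i₀ h (fiberIntegral i₀ c h) z₀ := by
  set s := z₀ i₀ with hs
  obtain ⟨t, η, hη, H⟩ := exists_local_primitive hc hprim hz₀ hz₀.1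
  have hprim₀ := ((H z₀ (Metric.mem_ball_self hη)).2 s (Metric.mem_ball_self hη)).2.1
  have hprim₁ : IsPrimitiveAt i₀ h t z₀ := by
    rwa [hs, killCoord_add_smul_single] at hprim₀
  -- `A` is the discrepancy between the fibre integral and the local primitive `t`. It depends on
  -- the transverse coordinates only, so it adds nothing to the derivative in direction `i₀`.
  let A : EuclideanSpace ℝ (Fin N) → ℝ := fun z =>
    (∫ r in c..s, h (killCoord i₀ z + r • EuclideanSpace.single i₀ (1 : ℝ))) -
      t (killCoord i₀ z + s • EuclideanSpace.single i₀ (1 : ℝ))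
  have hA : ContDiffAt ℝ 1 A z₀ :=
    (contDiffAt_integral_fiber hc hprim hz₀ hcab hz₀.1).sub
      (hprim₀.1.comp z₀ (f := fun z => killCoord i₀ z + s • EuclideanSpace.single i₀ (1 : ℝ))
        ((killCoord i₀).contDiff.contDiffAt.add contDiffAt_const))
  have hA0 : fderiv ℝ A z₀ (EuclideanSpace.single i₀ 1) = 0 := by
    have h1 := (hA.differentiableAt one_ne_zero).hasFDerivAt.hasLineDerivAt
      (EuclideanSpace.single i₀ (1 : ℝ))
    have h2 : (fun r : ℝ => A (z₀ + r • EuclideanSpace.single i₀ (1 : ℝ))) = fun _ => A z₀ := by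
      ext1 r
      simp only [A, killCoord_add_smul_single_eq]
    have h3 : HasDerivAt (fun r : ℝ => A (z₀ + r • EuclideanSpace.single i₀ (1 : ℝ))) _ 0 := h1
    rw [h2] at h3
    exact h3.unique (hasDerivAt_const _ _)
  have heq : fiberIntegral i₀ c h =ᶠ[𝓝 z₀] fun z => A z + t z := by
    have hci : ContinuousAt (fun z : EuclideanSpace ℝ (Fin N) => z i₀) z₀ := by fun_prop
    filter_upwards [Metric.ball_mem_nhds z₀ hη, hci.eventually_mem (Metric.ball_mem_nhds _ hη)]
      with z hz hzi
    have h1 := ((H z hz).2 s (Metric.mem_ball_self hη)).2.2 _ hzi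
    rw [killCoord_add_smul_single] at h1
    rw [fiberIntegral, ← intervalIntegral.integral_add_adjacent_intervals
      (intervalIntegrable_fiber hc (H z hz).1 hcab hz₀.1)
      (intervalIntegrable_fiber hc (H z hz).1 hz₀.1 (H z hz).1.1), h1]
    simp only [A]
    ring
  refine ⟨(hA.add hprim₁.1).congr_of_eventuallyEq heq, ?_⟩
  rw [heq.fderiv_eq, fderiv_fun_add (hA.differentiableAt one_ne_zero)
    (hprim₁.1.differentiableAt one_ne_zero)]
  simp [hA0, hprim₁.2]

/-- Replacing the coordinate `i₀` by a primitive of a nonvanishing function is a change of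
coordinates. -/
theorem exists_coordinateSystem_of_primitive {h W : EuclideanSpace ℝ (Fin N) → ℝ}
    (hW : ∀ z ∈ ruledBox i₀ a b ε, IsPrimitiveAt i₀ h W z)
    (hne : ∀ z ∈ ruledBox i₀ a b ε, h z ≠ 0) :
    ∃ F : OpenPartialHomeomorph (EuclideanSpace ℝ (Fin N)) (EuclideanSpace ℝ (Fin N)),
      IsCoordinateSystem F (ruledBox i₀ a b ε) ∧ ∀ z ∈ ruledBox i₀ a b ε,
        fderiv ℝ F z (EuclideanSpace.single i₀ 1) = h z • EuclideanSpace.single i₀ (1 : ℝ) := by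
  let G : EuclideanSpace ℝ (Fin N) → EuclideanSpace ℝ (Fin N) := fun z =>
    killCoord i₀ z + W z • EuclideanSpace.single i₀ (1 : ℝ)
  have hG : ∀ z ∈ ruledBox i₀ a b ε, HasFDerivAt G (killCoord i₀ +
      (fderiv ℝ W z).smulRight (EuclideanSpace.single i₀ (1 : ℝ))) z := fun z hz =>
    (killCoord i₀).hasFDerivAt.add
      (((hW z hz).1.differentiableAt one_ne_zero).hasFDerivAt.smul_const _)
  have hGc : ContDiffOn ℝ 1 G (ruledBox i₀ a b ε) := fun z hz =>
    ((killCoord i₀).contDiff.contDiffAt.add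
      ((hW z hz).1.smul contDiffAt_const)).contDiffWithinAt
  have hkill : ∀ (v : EuclideanSpace ℝ (Fin N)) (r : ℝ),
      killCoord i₀ (killCoord i₀ v + r • EuclideanSpace.single i₀ (1 : ℝ)) = killCoord i₀ v := by
    intro v r
    rw [killCoord_add_smul_single_eq, killCoord_killCoord]
  have hinj : InjOn G (ruledBox i₀ a b ε) := by
    intro z hz w hw hzw
    have h1 : killCoord i₀ z = killCoord i₀ w := by
      rw [← hkill z (W z), ← hkill w (W w)]; exact congrArg _ hzw
    have h2 : W z = W w := by
      rw [← killCoord_add_smul_apply_self (i₀ := i₀) z (W z),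
        ← killCoord_add_smul_apply_self (i₀ := i₀) w (W w)]
      exact congrArg (fun y : EuclideanSpace ℝ (Fin N) => y i₀) hzw
    have hder : ∀ r ∈ Ioo a b, HasDerivAt
        (fun r : ℝ => W (killCoord i₀ z + r • EuclideanSpace.single i₀ (1 : ℝ)))
        (h (killCoord i₀ z + r • EuclideanSpace.single i₀ (1 : ℝ))) r := fun r hr =>
      (hW _ (killCoord_add_smul_mem_ruledBox hz hr)).hasDerivAt
    have hval : W (killCoord i₀ z + z i₀ • EuclideanSpace.single i₀ (1 : ℝ)) =
        W (killCoord i₀ z + w i₀ • EuclideanSpace.single i₀ (1 : ℝ)) := by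
      rw [killCoord_add_smul_single, h1, killCoord_add_smul_single, h2]
    -- By Rolle, equal values of `W` at two heights of a fibre would force a zero of `h` between
    -- them.
    have hrolle : ∀ r ∈ Ioo a b, ∀ r' ∈ Ioo a b, r < r' →
        W (killCoord i₀ z + r • EuclideanSpace.single i₀ (1 : ℝ)) ≠
        W (killCoord i₀ z + r' • EuclideanSpace.single i₀ (1 : ℝ)) := by
      intro r hr r' hr' hrr heq
      have hsub : Icc r r' ⊆ Ioo a b := ordConnected_Ioo.out hr hr'
      obtain ⟨ρ, hρ, h0⟩ := exists_hasDerivAt_eq_zero hrr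
        (fun ρ hρ => (hder ρ (hsub hρ)).continuousAt.continuousWithinAt) heq
        (fun ρ hρ => hder ρ (hsub (Ioo_subset_Icc_self hρ)))
      exact hne _ (killCoord_add_smul_mem_ruledBox hz (hsub (Ioo_subset_Icc_self hρ))) h0
    have h3 : z i₀ = w i₀ := by
      rcases lt_trichotomy (z i₀) (w i₀) with hlt | heq | hgt
      · exact absurd hval (hrolle _ hz.1 _ hw.1 hlt)
      · exact heq
      · exact absurd hval.symm (hrolle _ hw.1 _ hz.1 hgt)
    rw [← killCoord_add_smul_single (i₀ := i₀) z, ← killCoord_add_smul_single (i₀ := i₀) w, h1, h3]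
  have hd : ∀ z ∈ ruledBox i₀ a b ε, Function.Injective (fderiv ℝ G z) := by
    intro z hz
    rw [(hG z hz).fderiv, injective_iff_map_eq_zero]
    intro v hv
    have hv' : killCoord i₀ v + fderiv ℝ W z v • EuclideanSpace.single i₀ (1 : ℝ) = 0 := hv
    have h1 : killCoord i₀ v = 0 := by
      rw [← hkill v (fderiv ℝ W z v), hv', map_zero]
    have h2 : fderiv ℝ W z v = 0 := by
      rw [← killCoord_add_smul_apply_self (i₀ := i₀) v (fderiv ℝ W z v), hv']; rfl
    have h3 : v = v i₀ • EuclideanSpace.single i₀ (1 : ℝ) := by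
      have := killCoord_add_smul_single (i₀ := i₀) v
      rw [h1, zero_add] at this
      exact this.symm
    rw [h3, map_smul, (hW z hz).2, smul_eq_mul] at h2
    rw [h3, (mul_eq_zero.1 h2).resolve_right (hne z hz), zero_smul]
  obtain ⟨F, hFG, -, hF⟩ := exists_coordinateSystem_of_injOn (isOpen_ruledBox i₀ a b ε) hGc hinj hd
  refine ⟨F, hF, fun z hz => ?_⟩
  rw [hFG, (hG z hz).fderiv]
  simp [killCoord_single, (hW z hz).2]

/-- In a chart whose coordinates `j ≠ i₀` are constant along trajectories, the vector field is
parallel to the direction `i₀`. -/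
theorem fderiv_apply_eq_zero_of_const
    {P : EuclideanSpace ℝ (Fin N) → EuclideanSpace ℝ (Fin N)} (hP : ContDiff ℝ 1 P)
    {U : Set (EuclideanSpace ℝ (Fin N))}
    {ψ : OpenPartialHomeomorph (EuclideanSpace ℝ (Fin N)) (EuclideanSpace ℝ (Fin N))}
    (hψ : IsCoordinateSystem ψ U) {j : Fin N}
    (hconst : ∀ (γ : ℝ → EuclideanSpace ℝ (Fin N)) (c d : ℝ), IsTrajectoryIn P U γ c d →
      ∀ s ∈ Ioo c d, ∀ t ∈ Ioo c d, ψ (γ s) j = ψ (γ t) j)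
    {p : EuclideanSpace ℝ (Fin N)} (hp : p ∈ U) : fderiv ℝ ψ p (P p) j = 0 := by
  obtain ⟨γ, hγ0, δ, hδ, hγ⟩ :=
    hP.contDiffAt.exists_forall_mem_closedBall_exists_eq_forall_mem_Ioo_hasDerivAt₀ (x₀ := p) 0
  have h0 : (0 : ℝ) ∈ Ioo (0 - δ) (0 + δ) := ⟨by linarith, by linarith⟩
  have hev : ∀ᶠ t in 𝓝 (0 : ℝ), γ t ∈ U ∧ t ∈ Ioo (0 - δ) (0 + δ) :=
    ((hγ 0 h0).continuousAt.eventually_mem (hψ.isOpen.mem_nhds (hγ0.symm ▸ hp))).and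
      (isOpen_Ioo.mem_nhds h0)
  obtain ⟨η, hη, H⟩ := Metric.eventually_nhds_iff_ball.1 hev
  rw [Real.ball_eq_Ioo] at H
  have h0' : (0 : ℝ) ∈ Ioo (0 - η) (0 + η) := ⟨by linarith, by linarith⟩
  have htraj : IsTrajectoryIn P U γ (0 - η) (0 + η) :=
    ⟨isIntegralCurveOn_Ioo_iff.2 fun t ht => hγ t (H t ht).2, fun t ht => (H t ht).1⟩
  have h1 : HasDerivAt (fun t => ψ (γ t) j) (fderiv ℝ ψ p (P p) j) 0 := by
    have hd := ((hψ.contDiffAt hp).differentiableAt one_ne_zero).hasFDerivAt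
    have h2 := hγ 0 h0
    rw [hγ0] at h2
    have h3 : HasDerivAt (fun t => ψ (γ t)) (fderiv ℝ ψ p (P p)) 0 := by
      refine HasFDerivAt.comp_hasDerivAt (f := γ) 0 ?_ h2
      rw [hγ0]; exact hd
    exact (EuclideanSpace.proj j : EuclideanSpace ℝ (Fin N) →L[ℝ] ℝ).hasFDerivAt.comp_hasDerivAt
      0 h3
  refine h1.unique ((hasDerivAt_const (0 : ℝ) (ψ (γ 0) j)).congr_of_eventuallyEq ?_)
  filter_upwards [isOpen_Ioo.mem_nhds h0'] with t ht
  exact hconst γ _ _ htraj t ht 0 h0'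

/-- The dynamic is split on every regular neighborhood. -/
theorem IsRegularNeighborhood.isSplitOn
    {P : EuclideanSpace ℝ (Fin N) → EuclideanSpace ℝ (Fin N)} (hP : ContDiff ℝ 1 P)
    {S U : Set (EuclideanSpace ℝ (Fin N))} (hU : IsRegularNeighborhood P S U) :
    IsSplitOn P U := by
  obtain ⟨hUo, -, hne, ψ, i₀, a, b, ε, hab, -, hψ, htgt, hconst⟩ := hU
  change ψ.target = ruledBox i₀ a b ε at htgt
  let v : EuclideanSpace ℝ (Fin N) → ℝ := fun z =>
    fderiv ℝ ψ (ψ.symm z) (P (ψ.symm z)) i₀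
  have hsymm : ∀ z ∈ ruledBox i₀ a b ε, ψ.symm z ∈ U := fun z hz =>
    hψ.1 ▸ ψ.map_target (htgt ▸ hz)
  have hright : ∀ z ∈ ruledBox i₀ a b ε, ψ (ψ.symm z) = z := fun z hz =>
    ψ.right_inv (htgt ▸ hz)
  have hpar : ∀ p ∈ U, fderiv ℝ ψ p (P p) =
      fderiv ℝ ψ p (P p) i₀ • EuclideanSpace.single i₀ (1 : ℝ) := by
    intro p hp
    ext j
    by_cases hj : j = i₀
    · subst hj; simp
    · rw [fderiv_apply_eq_zero_of_const hP hψ (fun γ c d h => hconst γ c d h j hj) hp]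
      simp [hj]
  have hv0 : ∀ z ∈ ruledBox i₀ a b ε, v z ≠ 0 := by
    intro z hz h0
    obtain ⟨e, he, -⟩ := hψ.exists_equiv (hsymm z hz)
    have h1 := hpar _ (hsymm z hz)
    change _ = v z • _ at h1
    rw [h0, zero_smul, he.fderiv] at h1
    exact hne _ (hsymm z hz) (e.map_eq_zero_iff.1 h1)
  have hvc : ContinuousOn v (ruledBox i₀ a b ε) := by
    have h1 : ContinuousOn ψ.symm (ruledBox i₀ a b ε) := htgt ▸ ψ.continuousOn_symm
    have h2 : ContinuousOn (fderiv ℝ ψ) U :=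
      (hψ.1 ▸ hψ.2.1 : ContDiffOn ℝ 1 ψ U).continuousOn_fderiv_of_isOpen hUo le_rfl
    have h3 := (h2.comp h1 hsymm).clm_apply (hP.continuous.comp_continuousOn h1)
    exact (EuclideanSpace.proj i₀ : EuclideanSpace ℝ (Fin N) →L[ℝ] ℝ).continuous.comp_continuousOn h3
  -- The time coordinate `χ_{i₁}` of a flow box grows at unit rate along `P`. As `Dψ⁻¹ e_{i₀} = v⁻¹
  -- P`, its derivative in direction `i₀`, read in the chart `ψ`, is `1/v`.
  have hprim : ∀ z ∈ ruledBox i₀ a b ε,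
      ∃ t, ∀ᶠ w in 𝓝 z, IsPrimitiveAt i₀ (fun z => (v z)⁻¹) t w := by
    intro z₀ hz₀
    -- A single point is a degenerate orbit with `T = 0`, where the differential equation is
    -- vacuous; the flow box theorem admits this case.
    have hsimple : IsSimpleOrbit P (ψ.symm z₀) 0 (fun _ => ψ.symm z₀) := by
      refine ⟨?_, rfl, ?_, fun t _ => hne _ (hsymm z₀ hz₀)⟩
      · intro t ht
        rw [Icc_self] at ht ⊢
        rw [mem_singleton_iff.1 ht]
        exact HasFDerivWithinAt.of_subsingleton subsingleton_singleton
      · rw [Icc_self]; exact injOn_singleton _ _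
    obtain ⟨χ, i₁, -, -, -, -, -, hχU, hmem, hχ, -, hχP⟩ := exists_flowBox hP le_rfl hsimple hUo
      (by rintro _ ⟨t, -, rfl⟩; exact hsymm z₀ hz₀)
    have hmem' : ψ.symm z₀ ∈ χ.source := hmem ⟨0, ⟨le_rfl, le_rfl⟩, rfl⟩
    refine ⟨fun z => χ (ψ.symm z) i₁, ?_⟩
    have hz₀t : z₀ ∈ ψ.target := htgt ▸ hz₀
    filter_upwards [(ψ.continuousAt_symm hz₀t).eventually_mem (χ.open_source.mem_nhds hmem'),
      (isOpen_ruledBox i₀ a b ε).mem_nhds hz₀] with w hw hwB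
    have hwt : w ∈ ψ.target := htgt ▸ hwB
    have h1 : ContDiffAt ℝ 1 (fun z => χ (ψ.symm z)) w :=
      (hχ.contDiffAt hw).comp w (hψ.symm.contDiffAt hwt)
    refine ⟨(EuclideanSpace.proj i₁ : EuclideanSpace ℝ (Fin N) →L[ℝ] ℝ).contDiff.contDiffAt.comp
      w h1, ?_⟩
    obtain ⟨e, he, he'⟩ := hψ.exists_equiv (hsymm w hwB)
    rw [hright w hwB] at he'
    have h2 : HasFDerivAt (fun z => χ (ψ.symm z) i₁) _ w :=
      (EuclideanSpace.proj i₁ : EuclideanSpace ℝ (Fin N) →L[ℝ] ℝ).hasFDerivAt.comp w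
        (((hχ.contDiffAt hw).differentiableAt one_ne_zero).hasFDerivAt.comp w he')
    have h3 : e.symm (EuclideanSpace.single i₀ (1 : ℝ)) = (v w)⁻¹ • P (ψ.symm w) := by
      rw [ContinuousLinearEquiv.symm_apply_eq, map_smul]
      have h4 := hpar _ (hsymm w hwB)
      change _ = v w • _ at h4
      rw [he.fderiv] at h4
      change e _ = _ at h4
      rw [h4, smul_smul, inv_mul_cancel₀ (hv0 w hwB), one_smul]
    rw [h2.fderiv]
    change (fderiv ℝ χ (ψ.symm w) (e.symm (EuclideanSpace.single i₀ (1 : ℝ)))) i₁ = _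
    rw [h3, map_smul, (hχP _ hw).2]
    simp
  -- The midpoint serves merely as a base height inside `(a, b)`.
  have hW : ∀ z ∈ ruledBox i₀ a b ε, IsPrimitiveAt i₀ (fun z => (v z)⁻¹)
      (fiberIntegral i₀ ((a + b) / 2) fun z => (v z)⁻¹) z := fun z hz =>
    isPrimitiveAt_fiberIntegral (hvc.inv₀ hv0) hprim ⟨by linarith, by linarith⟩ hz
  obtain ⟨G, hG, hGd⟩ := exists_coordinateSystem_of_primitive hW
    (fun z hz => inv_ne_zero (hv0 z hz))
  have hG' : IsCoordinateSystem G ψ.target := htgt ▸ hG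
  have hF := hψ.trans hG'
  -- With elapsed time as coordinate `i₀`, the factors `v` and `1/v` cancel and the field becomes
  -- `e_{i₀}`.
  refine ⟨ψ.trans G, fun i _ => if i = i₀ then 1 else 0, hF, fun p hp => hF.det_fderiv_ne_zero hp,
    fun i => continuousOn_const, fun γ c d hγ => hF.isIntegralCurveOn_iff (fun p hp => ?_) hγ⟩
  have hψp : ψ p ∈ ruledBox i₀ a b ε := htgt ▸ ψ.map_source (hψ.1.symm ▸ hp)
  have hinv : ψ.symm (ψ p) = p := ψ.left_inv (hψ.1.symm ▸ hp)
  have hd : HasFDerivAt (ψ.trans G) _ p :=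
    ((hG.contDiffAt hψp).differentiableAt one_ne_zero).hasFDerivAt.comp p
      ((hψ.contDiffAt hp).differentiableAt one_ne_zero).hasFDerivAt
  have hvp : v (ψ p) = fderiv ℝ ψ p (P p) i₀ := by simp only [v, hinv]
  rw [hd.fderiv, ContinuousLinearMap.comp_apply, hpar p hp, map_smul, hGd _ hψp, ← hvp, smul_smul,
    mul_inv_cancel₀ (hv0 _ hψp), one_smul]
  ext j
  simp [splitField, PiLp.single_apply]

end Splitting

theorem mainTheorem7 {N : ℕ}
    (P : EuclideanSpace ℝ (Fin N) → EuclideanSpace ℝ (Fin N)) (hP : ContDiff ℝ 1 P)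
    (x₀ : EuclideanSpace ℝ (Fin N)) (T : ℝ) (hT : 0 < T)
    (x : ℝ → EuclideanSpace ℝ (Fin N)) (hx : IsSimpleOrbit P x₀ T x) :
    (∀ U : Set (EuclideanSpace ℝ (Fin N)),
      IsRegularNeighborhood P (x '' Icc 0 T) U → IsSplitOn P U) ∧
    (∀ O : Set (EuclideanSpace ℝ (Fin N)), IsOpen O → x '' Icc 0 T ⊆ O →
      ∃ U ⊆ O, IsRegularNeighborhood P (x '' Icc 0 T) U ∧ IsSplitOn P U) := by
  refine ⟨fun U hU => hU.isSplitOn hP, fun O hO hxO => ?_⟩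
  obtain ⟨ψ, i₀, a, b, ε, hab, hε, hψO, hxψ, hψ, ht, h⟩ := exists_flowBox hP hT.le hx hO hxO
  have hreg := IsRegularNeighborhood.of_flowBox hab hε hxψ hψ ht h
  exact ⟨ψ.source, hψO, hreg, hreg.isSplitOn hP⟩
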